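/- Let $H=\ell^2(\mathbb N)$ be the Fock space of one bosonic mode, with number states $|n\rangle$, annihilation operator $\hat a$, and coherent states $|\alpha\rangle=e^{-|\alpha|^2/2}\sum_{n\ge 0}\frac{\alpha^n}{\sqrt{n!}}|n\rangle$, $\alpha\in\mathbb C$. On $H\otimes H$ let $\hat a,\hat b$ be the annihilation operators of the two factors. The quantum limited amplifier of strength $\kappa\ge1$ and the quantum limited attenuator of strength $\lambda\in[0,1]$ are $$\mathcal A_\kappa(\hat X)=\operatorname{Tr}_2\big[\hat S_\kappa(\hat X\otimes|0\rangle\langle0|)\hat S_\kappa^\dagger\big],\qquad \hat S_\kappa=\exp\big[\operatorname{arcosh}\sqrt\kappa\,(\hat a^\dagger\hat b^\dagger-\hat a\hat b)\big],$$ $$\mathcal E_\lambda(\hat X)=\operatorname{Tr}_2\big[\hat B_\lambda(\hat X\otimes|0\rangle\langle0|)\hat B_\lambda^\dagger\big],\qquad \hat B_\lambda=\exp\big[\arccos\sqrt\lambda\,(\hat a^\dagger\hat b-\hat a\hat b^\dagger)\big].$$ The exponential $\exp G$ is the value at time $1$ of the strongly continuous one-parameter unitary group whose generator extends $G$ defined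 on finite linear combinations of the vectors $|m\rangle\otimes|n\rangle$. The partial trace $Y=\operatorname{Tr}_2T$ is the bounded operator with $\langle u|Y|v\rangle=\sum_n\langle u\otimes b_n|T|v\otimes b_n\rangle$ (unconditionally convergent) for all $u,v\in H$ and every orthonormal basis $(b_n)$ of $H$. Put $\mathcal C:=\mathcal E_{1/2}\circ\mathcal A_2$. Then $\hat S_2$ and $\hat B_{1/2}$ exist and are unique, $\mathcal A_2(\hat X)$ and $\mathcal E_{1/2}(\hat X)$ are well defined for every bounded operator $\hat X$ on $H$ (in particular for every density operator), and, as maps on bounded operators, $$\mathcal C^2=\mathcal A_2\circ\mathcal E_{1/2}.$$ Moreover, $\mathcal C^2$ is the projection onto coherent states: for every bounded operator $\hat X$ on $H$, $$\mathcal C^2(\hat X)=\int_{\mathbb C}\frac{d^2\alpha}{\pi}\,|\alpha\rangle\langle\alpha|\hat X|\alpha\rangle\langle\alpha|,$$ where $d^2\alpha$ is Lebesgue measure on the plane and the integral is in the weak sense: for all $u,v\in H$ the function $\alpha\mapsto\langle u|\alpha\rangle\langle\alpha|\hat X|\alpha\rangle\langle\alpha|v\rangle$ is integrable, and its integral divided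 by $\pi$ is $\langle u|\mathcal C^2(\hat X)|v\rangle$. -/

import Mathlib

open scoped lp InnerProductSpace

namespace BosonicChannels

noncomputable section

/-- The Fock space of one mode; the `n`-th coordinate vector is the number state `|n⟩`. -/
abbrev Fock : Type := ℓ²(ℕ, ℂ)

/-- The Hilbert tensor product of two copies of `Fock` (system and ancilla);
the coordinate vector with index `(m, n)` is `|m⟩ ⊗ |n⟩`. -/
abbrev Fock2 : Type := ℓ²(ℕ × ℕ, ℂ)

/-- The vacuum `|0⟩`. -/
def vacuum : Fock := lp.single 2 0 (1 : ℂ)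

/-! ### Product vectors and partial trace -/

theorem lp_two_summable {ι : Type*} (u : ℓ²(ι, ℂ)) : Summable fun i => ‖u i‖ ^ 2 := by
  have h := (lp.memℓp u).summable (by norm_num)
  simpa using h

theorem memℓp_two {ι : Type*} {f : ι → ℂ} (h : Summable fun i => ‖f i‖ ^ 2) :
    Memℓp (E := fun _ : ι => ℂ) f 2 := by
  apply memℓp_gen
  simpa using h

/-- The product vector `u ⊗ v`. -/
def tensor (u v : Fock) : Fock2 :=
  ⟨fun p => u p.1 * v p.2, memℓp_two (by
    have h := (lp_two_summable u).mul_of_nonneg (lp_two_summable v)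
      (fun _ => by positivity) (fun _ => by positivity)
    simpa [norm_mul, mul_pow] using h)⟩

@[simp] theorem tensor_apply (u v : Fock) (p : ℕ × ℕ) : tensor u v p = u p.1 * v p.2 := rfl

theorem hasSum_mul_prod {f g : ℕ → ℂ} {a b : ℂ} (hf : HasSum f a) (hg : HasSum g b) :
    HasSum (fun p : ℕ × ℕ => f p.1 * g p.2) (a * b) := by
  have h : Summable fun p : ℕ × ℕ => f p.1 * g p.2 :=
    summable_mul_of_summable_norm hf.summable.norm hg.summable.norm
  exact hf.mul hg h

theorem inner_tensor (u v u' v' : Fock) :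
    ⟪tensor u v, tensor u' v'⟫_ℂ = ⟪u, u'⟫_ℂ * ⟪v, v'⟫_ℂ := by
  have h1 : HasSum (fun i => ⟪u i, u' i⟫_ℂ) ⟪u, u'⟫_ℂ := lp.hasSum_inner u u'
  have h2 : HasSum (fun i => ⟪v i, v' i⟫_ℂ) ⟪v, v'⟫_ℂ := lp.hasSum_inner v v'
  have h3 : HasSum (fun p => ⟪tensor u v p, tensor u' v' p⟫_ℂ) ⟪tensor u v, tensor u' v'⟫_ℂ :=
    lp.hasSum_inner (tensor u v) (tensor u' v')
  have h4 := hasSum_mul_prod h1 h2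
  have h5 : (fun p => ⟪tensor u v p, tensor u' v' p⟫_ℂ) =
      fun p : ℕ × ℕ => ⟪u p.1, u' p.1⟫_ℂ * ⟪v p.2, v' p.2⟫_ℂ := by
    funext p
    simp only [tensor_apply, RCLike.inner_apply, map_mul]
    ring
  rw [h5] at h3
  exact h3.unique h4

theorem norm_tensor (u v : Fock) : ‖tensor u v‖ = ‖u‖ * ‖v‖ := by
  have h := inner_tensor u v u v
  simp only [inner_self_eq_norm_sq_to_K] at h
  have h' : ‖tensor u v‖ ^ 2 = (‖u‖ * ‖v‖) ^ 2 := by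
    rw [mul_pow]
    exact_mod_cast h
  exact (pow_left_inj₀ (norm_nonneg _) (by positivity) two_ne_zero).1 h'

/-- The bounded operator `u ↦ u ⊗ v`. -/
def tensorRight (v : Fock) : Fock →L[ℂ] Fock2 :=
  LinearMap.mkContinuous
    { toFun := fun u => tensor u v
      map_add' := fun u u' => by ext p; simp [add_mul]
      map_smul' := fun c u => by ext p; simp [mul_assoc] }
    ‖v‖ (fun u => by
      rw [mul_comm]
      exact (norm_tensor u v).le)

@[simp] theorem tensorRight_apply (u v : Fock) : tensorRight v u = tensor u v := rfl

theorem tensorRight_adjoint_tensor (w u v : Fock) :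
    (tensorRight w).adjoint (tensor u v) = ⟪w, v⟫_ℂ • u := by
  refine ext_inner_left ℂ fun x => ?_
  rw [ContinuousLinearMap.adjoint_inner_right, tensorRight_apply, inner_tensor,
    inner_smul_right, mul_comm]

/-- The operator `X ⊗ |0⟩⟨0|`. -/
def tensorVacuum (X : Fock →L[ℂ] Fock) : Fock2 →L[ℂ] Fock2 :=
  tensorRight vacuum ∘L X ∘L (tensorRight vacuum).adjoint

theorem tensorVacuum_tensor (X : Fock →L[ℂ] Fock) (u v : Fock) :
    tensorVacuum X (tensor u v) =
      tensor (X u) (InnerProductSpace.rankOne ℂ vacuum vacuum v) := by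
  ext p
  simp [tensorVacuum, tensorRight_adjoint_tensor, mul_left_comm]

/-- `Y` is the partial trace of `T` over the second factor:
`⟨u|Y|v⟩ = ∑ₙ ⟨u ⊗ bₙ|T|v ⊗ bₙ⟩` for all `u`, `v` and every orthonormal basis `b`. -/
def IsPartialTrace (T : Fock2 →L[ℂ] Fock2) (Y : Fock →L[ℂ] Fock) : Prop :=
  ∀ (b : HilbertBasis ℕ ℂ Fock) (u v : Fock),
    HasSum (fun n => ⟪tensor u (b n), T (tensor v (b n))⟫_ℂ) ⟪u, Y v⟫_ℂ

open Classical in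
/-- The partial trace `Tr₂ T` (and `0` if `T` has none). -/
def partialTrace (T : Fock2 →L[ℂ] Fock2) : Fock →L[ℂ] Fock :=
  if h : ∃ Y, IsPartialTrace T Y then h.choose else 0

/-! ### Ladder operators and unitary exponentials -/

/-- Finite linear combinations of the vectors `|m⟩ ⊗ |n⟩`. -/
abbrev FiniteVec : Type := ℕ × ℕ →₀ ℂ

/-- The inclusion of the finite vectors in the Hilbert space. -/
def toFock2 : FiniteVec →ₗ[ℂ] Fock2 :=
  Finsupp.linearCombination ℂ fun p => lp.single 2 p (1 : ℂ)

/-- Annihilation operator of the system: `a |m, n⟩ = √m |m - 1, n⟩`. -/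
def opA : Module.End ℂ FiniteVec :=
  Finsupp.linearCombination ℂ fun p => Finsupp.single (p.1 - 1, p.2) (Real.sqrt p.1 : ℂ)

/-- Creation operator of the system: `a† |m, n⟩ = √(m + 1) |m + 1, n⟩`. -/
def opADag : Module.End ℂ FiniteVec :=
  Finsupp.linearCombination ℂ fun p => Finsupp.single (p.1 + 1, p.2) (Real.sqrt (p.1 + 1) : ℂ)

/-- Annihilation operator of the ancilla: `b |m, n⟩ = √n |m, n - 1⟩`. -/
def opB : Module.End ℂ FiniteVec :=
  Finsupp.linearCombination ℂ fun p => Finsupp.single (p.1, p.2 - 1) (Real.sqrt p.2 : ℂ)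

/-- Creation operator of the ancilla: `b† |m, n⟩ = √(n + 1) |m, n + 1⟩`. -/
def opBDag : Module.End ℂ FiniteVec :=
  Finsupp.linearCombination ℂ fun p => Finsupp.single (p.1, p.2 + 1) (Real.sqrt (p.2 + 1) : ℂ)

/-- `U = exp G` for a skew-symmetric operator `G` on the finite vectors: `U = V 1`, where
`V` is a strongly continuous one-parameter unitary group whose generator extends `G`.
If `G` is essentially skew-adjoint, the generator is the closure of `G` and `U` is unique. -/
def IsUnitaryExp (G : Module.End ℂ FiniteVec) (U : Fock2 →L[ℂ] Fock2) : Prop :=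
  ∃ V : ℝ → Fock2 →L[ℂ] Fock2,
    V 0 = 1 ∧ (∀ s t, V (s + t) = V s * V t) ∧ (∀ t, V t ∈ unitary (Fock2 →L[ℂ] Fock2)) ∧
    (∀ x, Continuous fun t => V t x) ∧
    (∀ f : FiniteVec, HasDerivAt (fun t => V t (toFock2 f)) (toFock2 (G f)) 0) ∧
    U = V 1

open Classical in
/-- The operator `exp G` (and `0` if there is none). -/
def unitaryExp (G : Module.End ℂ FiniteVec) : Fock2 →L[ℂ] Fock2 :=
  if h : ∃ U, IsUnitaryExp G U then h.choose else 0

/-! ### The channels -/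

/-- `arcosh √κ (a† b† - a b)`. -/
def squeezingGenerator (κ : ℝ) : Module.End ℂ FiniteVec :=
  (Real.arcosh (Real.sqrt κ) : ℂ) • (opADag * opBDag - opA * opB)

/-- `arccos √lam (a† b - a b†)`. -/
def beamsplitterGenerator (lam : ℝ) : Module.End ℂ FiniteVec :=
  (Real.arccos (Real.sqrt lam) : ℂ) • (opADag * opB - opA * opBDag)

/-- The two-mode squeezing operator, for `1 ≤ κ`. -/
def squeezing (κ : ℝ) : Fock2 →L[ℂ] Fock2 := unitaryExp (squeezingGenerator κ)

/-- The two-mode beamsplitter operator, for `0 ≤ lam ≤ 1`. -/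
def beamsplitter (lam : ℝ) : Fock2 →L[ℂ] Fock2 := unitaryExp (beamsplitterGenerator lam)

/-- The joint output `W (X ⊗ |0⟩⟨0|) W†`, before the ancilla is traced out. -/
def dilation (W : Fock2 →L[ℂ] Fock2) (X : Fock →L[ℂ] Fock) : Fock2 →L[ℂ] Fock2 :=
  W ∘L tensorVacuum X ∘L W.adjoint

/-- The quantum limited amplifier of strength `κ`. -/
def amplifier (κ : ℝ) (X : Fock →L[ℂ] Fock) : Fock →L[ℂ] Fock :=
  partialTrace (dilation (squeezing κ) X)

/-- The quantum limited attenuator of strength `lam`. -/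
def attenuator (lam : ℝ) (X : Fock →L[ℂ] Fock) : Fock →L[ℂ] Fock :=
  partialTrace (dilation (beamsplitter lam) X)

/-- The channel `C`: first the amplifier of strength `2`, then the attenuator of strength `1/2`. -/
def channelC : (Fock →L[ℂ] Fock) → (Fock →L[ℂ] Fock) := attenuator (1 / 2) ∘ amplifier 2

/-! ### Coherent states -/

theorem hasSum_coherent_sq (α : ℂ) :
    HasSum (fun n : ℕ =>
      ‖(Real.exp (-‖α‖ ^ 2 / 2) : ℂ) * (α ^ n / (Real.sqrt (n.factorial : ℝ) : ℂ))‖ ^ 2) 1 := by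
  have h := (NormedSpace.expSeries_div_hasSum_exp (𝔸 := ℝ) (‖α‖ ^ 2)).mul_left
    (Real.exp (-‖α‖ ^ 2))
  rw [← Real.exp_eq_exp_ℝ, ← Real.exp_add, neg_add_cancel, Real.exp_zero] at h
  refine h.congr_fun fun n => ?_
  have h1 : Real.exp (-‖α‖ ^ 2 / 2) ^ 2 = Real.exp (-‖α‖ ^ 2) := by
    rw [← Real.exp_nat_mul]
    congr 1
    push_cast
    ring
  rw [norm_mul, norm_div, norm_pow, Complex.norm_real, Complex.norm_real, mul_pow, div_pow,
    Real.norm_eq_abs, Real.norm_eq_abs, sq_abs, sq_abs, h1, Real.sq_sqrt (by positivity)]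
  ring

/-- The coherent state `|α⟩ = exp (-|α|² / 2) ∑ₙ αⁿ / √(n!) |n⟩`. -/
def coherent (α : ℂ) : Fock :=
  ⟨fun n => (Real.exp (-‖α‖ ^ 2 / 2) : ℂ) * (α ^ n / (Real.sqrt (n.factorial : ℝ) : ℂ)),
    memℓp_two (hasSum_coherent_sq α).summable⟩

@[simp] theorem coherent_apply (α : ℂ) (n : ℕ) : coherent α n =
    (Real.exp (-‖α‖ ^ 2 / 2) : ℂ) * (α ^ n / (Real.sqrt (n.factorial : ℝ) : ℂ)) := rfl

theorem norm_coherent (α : ℂ) : ‖coherent α‖ = 1 := by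
  have h := lp.hasSum_norm (p := 2) (by norm_num) (coherent α)
  simp only [ENNReal.toReal_ofNat, Real.rpow_ofNat] at h
  have h2 : ‖coherent α‖ ^ 2 = 1 := h.unique (hasSum_coherent_sq α)
  exact (pow_eq_one_iff_of_nonneg (norm_nonneg _) two_ne_zero).1 h2

/-- Coherent states are the eigenvectors of the annihilation operator:
the `n`-th coordinate of `a |α⟩` is `√(n + 1)` times the coordinate of index `n + 1`. -/
theorem coherent_eigen (α : ℂ) (n : ℕ) :
    (Real.sqrt (n + 1) : ℂ) * coherent α (n + 1) = α * coherent α n := by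
  have h1 : (Real.sqrt ((n : ℝ) + 1) : ℂ) ≠ 0 := by
    exact_mod_cast (Real.sqrt_pos.2 (by positivity)).ne'
  have h2 : (Real.sqrt (n.factorial : ℝ) : ℂ) ≠ 0 := by
    exact_mod_cast (Real.sqrt_pos.2 (by positivity)).ne'
  simp only [coherent_apply, Nat.factorial_succ]
  push_cast
  rw [Real.sqrt_mul (by positivity)]
  push_cast
  field_simp
  ring

/-- The projection `|α⟩⟨α|`. -/
def coherentProj (α : ℂ) : Fock →L[ℂ] Fock :=
  InnerProductSpace.rankOne ℂ (coherent α) (coherent α)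

/-- `Y = ∫ d²α/π F(α)` in the weak sense: for all `u`, `v` the function `α ↦ ⟨u|F(α)|v⟩` is
integrable over the plane and `⟨u|Y|v⟩ = ∫ d²α/π ⟨u|F(α)|v⟩`. -/
def IsPhaseSpaceIntegral (F : ℂ → Fock →L[ℂ] Fock) (Y : Fock →L[ℂ] Fock) : Prop :=
  ∀ u v : Fock, MeasureTheory.Integrable (fun α => ⟪u, F α v⟫_ℂ) ∧
    ⟪u, Y v⟫_ℂ = (Real.pi : ℂ)⁻¹ * ∫ α, ⟪u, F α v⟫_ℂ

end

end BosonicChannels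

open Filter Topology ComplexConjugate MeasureTheory

namespace BosonicChannels

noncomputable section

/-! ### Coordinate vectors -/

/-! Write `A` for the amplifier of strength 2, `E` for the attenuator of strength 1/2, `e(β) = ∑
βⁿ/√(n!) |n⟩` for the exponential vectors and `Q_X(α) = ⟨α|X|α⟩`. The `e(β)` span a dense subspace,
so a bounded operator is known from its kernel `⟨e(β), Y e(γ)⟩`, and everything reduces to Gaussian
integrals.

The amplifier dilates the Husimi function: `Q_{A X}(α) = ½ Q_X(α/√2)` (`husimi_amplifier`). The
kernel of `E X` is the integral of `Q_X` against an explicit Gaussian (`attenuator_kernel`).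
Together they show that `P = A ∘ E` measures coherent states and prepares the outcome
(`amplifier_attenuator_kernel`). Now `C² = E ∘ A ∘ E ∘ A = E ∘ P ∘ A`. Amplifying before the
measurement enlarges the outcome by `√2`, and attenuating the prepared coherent state shrinks its
amplitude by `√2`. The scalings cancel, so `E ∘ P ∘ A = P`. On kernels this is Fubini, one Gaussian
integral and the substitution `ζ = √2 α` (`channelC_channelC_kernel`).

Three analytic points support this. First, the generators are unbounded, but finite vectors are
analytic for them: `Gᵏ f` grows like `(4c)ᵏ k!`. This gives uniqueness of bounded weak solutions,
and existence of the group as a limit of exponentials of finite truncations. The unitaries are then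
evaluated on `|m, 0⟩` by exhibiting a bounded solution of the coordinate equations. Second, `X` is
only bounded, so convergence of the partial traces is not automatic; it holds because `v ↦ J†(u ⊗
v)`, with `J u = W(u ⊗ |0⟩)`, is Hilbert–Schmidt (`exists_isPartialTrace`). Third, the attenuator
formula is computed on rank one operators and extended to all bounded `X` by normality
(`functional_ext`). -/

/-- The coordinate vector `|i⟩`. -/
def ket {ι : Type*} [DecidableEq ι] (i : ι) : ℓ²(ι, ℂ) := lp.single 2 i (1 : ℂ)

section ket
variable {ι : Type*} [DecidableEq ι]

theorem inner_ket_left (i : ι) (x : ℓ²(ι, ℂ)) : ⟪ket i, x⟫_ℂ = x i := by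
  simp [ket, lp.inner_single_left]

theorem inner_ket_right (x : ℓ²(ι, ℂ)) (i : ι) : ⟪x, ket i⟫_ℂ = conj (x i) := by
  rw [← inner_conj_symm, inner_ket_left]

theorem ket_apply (i j : ι) : ket i j = if j = i then (1 : ℂ) else 0 := by
  simp [ket, lp.single_apply, Pi.single_apply]

theorem norm_ket (i : ι) : ‖ket i‖ = 1 := by
  simp [ket]

/-- The coordinate basis. -/
def ketBasis (ι : Type*) : HilbertBasis ι ℂ ℓ²(ι, ℂ) :=
  HilbertBasis.ofRepr (LinearIsometryEquiv.refl ℂ _)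

theorem ketBasis_apply (i : ι) : ketBasis ι i = ket i := by
  rw [← HilbertBasis.repr_symm_single]
  rfl

end ket

theorem toFock2_single (p : ℕ × ℕ) (c : ℂ) : toFock2 (Finsupp.single p c) = c • ket p := by
  simp [toFock2, ket]

theorem toFock2_apply (f : FiniteVec) (p : ℕ × ℕ) : toFock2 f p = f p := by
  induction f using Finsupp.induction_linear with
  | zero => simp
  | add f g hf hg => simp [hf, hg]
  | single q c =>
    rw [toFock2_single]
    simp [ket_apply, Finsupp.single_apply, eq_comm]

theorem denseRange_toFock2 : DenseRange toFock2 := by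
  have h := (ketBasis (ℕ × ℕ)).dense_span
  have h2 : (Submodule.span ℂ (Set.range (ketBasis (ℕ × ℕ)))) ≤ LinearMap.range toFock2 := by
    rw [Submodule.span_le]
    rintro _ ⟨p, rfl⟩
    exact ⟨Finsupp.single p 1, by rw [toFock2_single, one_smul, ketBasis_apply]⟩
  have h3 : Dense (Submodule.span ℂ (Set.range (ketBasis (ℕ × ℕ))) : Set Fock2) :=
    Submodule.dense_iff_topologicalClosure_eq_top.2 h
  exact h3.mono h2

/-! ### Finite vectors are analytic for ladder operators -/

/-- The `ℓ¹` norm of a finite vector. -/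
def ellOne (f : FiniteVec) : ℝ := f.sum fun _ c => ‖c‖

theorem ellOne_nonneg (f : FiniteVec) : 0 ≤ ellOne f :=
  Finset.sum_nonneg fun _ _ => norm_nonneg _

theorem ellOne_eq_sum {f : FiniteVec} {s : Finset (ℕ × ℕ)} (h : f.support ⊆ s) :
    ellOne f = ∑ p ∈ s, ‖f p‖ :=
  Finsupp.sum_of_support_subset f h _ (by simp)

theorem ellOne_zero : ellOne 0 = 0 := by simp [ellOne]

theorem ellOne_add_le (f g : FiniteVec) : ellOne (f + g) ≤ ellOne f + ellOne g := by
  rw [ellOne_eq_sum (s := f.support ∪ g.support) Finsupp.support_add,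
    ellOne_eq_sum (f := f) Finset.subset_union_left,
    ellOne_eq_sum (f := g) Finset.subset_union_right, ← Finset.sum_add_distrib]
  exact Finset.sum_le_sum fun p _ => norm_add_le _ _

theorem ellOne_smul (c : ℂ) (f : FiniteVec) : ellOne (c • f) = ‖c‖ * ellOne f := by
  rw [ellOne_eq_sum (f := c • f) (s := f.support) Finsupp.support_smul,
    ellOne_eq_sum (f := f) subset_rfl, Finset.mul_sum]
  simp

theorem ellOne_single (p : ℕ × ℕ) (c : ℂ) : ellOne (Finsupp.single p c) = ‖c‖ := by
  simp [ellOne]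

theorem ellOne_sum_le {ι : Type*} (s : Finset ι) (f : ι → FiniteVec) :
    ellOne (∑ i ∈ s, f i) ≤ ∑ i ∈ s, ellOne (f i) :=
  Finset.le_sum_of_subadditive ellOne ellOne_zero.le ellOne_add_le s f

theorem norm_toFock2_le (f : FiniteVec) : ‖toFock2 f‖ ≤ ellOne f := by
  rw [toFock2, Finsupp.linearCombination_apply, ellOne, Finsupp.sum, Finsupp.sum]
  refine (norm_sum_le _ _).trans (Finset.sum_le_sum fun p _ => ?_)
  rw [norm_smul]
  simp

theorem end_apply_eq_sum (G : Module.End ℂ FiniteVec) (f : FiniteVec) :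
    G f = ∑ p ∈ f.support, f p • G (Finsupp.single p 1) := by
  conv_lhs => rw [← Finsupp.sum_single f]
  rw [Finsupp.sum, map_sum]
  refine Finset.sum_congr rfl fun p _ => ?_
  rw [← map_smul]
  simp

/-- A skew-symmetric operator on the finite vectors that raises the total number by at most two,
with coefficients growing linearly in the total number. -/
structure IsSkewLadder (G : Module.End ℂ FiniteVec) (c : ℝ) : Prop where
  skew : ∀ p q, G (Finsupp.single p 1) q = -conj (G (Finsupp.single q 1) p)
  bound : ∀ p : ℕ × ℕ, ellOne (G (Finsupp.single p 1)) ≤ c * (p.1 + p.2 + 2)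
  level : ∀ p q : ℕ × ℕ, G (Finsupp.single p 1) q ≠ 0 → q.1 + q.2 ≤ p.1 + p.2 + 2

/-- All occupied states have total number at most `L`. -/
def LevelLE (L : ℕ) (f : FiniteVec) : Prop := ∀ p : ℕ × ℕ, f p ≠ 0 → p.1 + p.2 ≤ L

theorem exists_levelLE (f : FiniteVec) : ∃ L, LevelLE L f :=
  ⟨f.support.sup fun p => p.1 + p.2, fun _ hp =>
    Finset.le_sup (f := fun p : ℕ × ℕ => p.1 + p.2) (Finsupp.mem_support_iff.2 hp)⟩

namespace IsSkewLadder

variable {G : Module.End ℂ FiniteVec} {c : ℝ}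

theorem nonneg (hG : IsSkewLadder G c) : 0 ≤ c := by
  have h := (ellOne_nonneg _).trans (hG.bound (0, 0))
  norm_num at h
  linarith

theorem neg (hG : IsSkewLadder G c) : IsSkewLadder (-G) c where
  skew p q := by simp [hG.skew p q]
  bound p := by
    have h := ellOne_smul (-1) (G (Finsupp.single p 1))
    have h2 := hG.bound p
    simp only [neg_smul, one_smul, norm_neg, norm_one, one_mul] at h
    rw [LinearMap.neg_apply, h]
    exact h2
  level p q h := hG.level p q (by simpa using h)

theorem levelLE_apply (hG : IsSkewLadder G c) {L : ℕ} {f : FiniteVec} (hf : LevelLE L f) :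
    LevelLE (L + 2) (G f) := by
  intro q hq
  rw [end_apply_eq_sum, Finsupp.finsetSum_apply] at hq
  obtain ⟨p, hp, h⟩ := Finset.exists_ne_zero_of_sum_ne_zero hq
  rw [Finsupp.smul_apply, smul_eq_mul] at h
  have h1 := hG.level p q (right_ne_zero_of_mul h)
  have h2 := hf p (left_ne_zero_of_mul h)
  omega

theorem levelLE_pow (hG : IsSkewLadder G c) {L : ℕ} {f : FiniteVec} (hf : LevelLE L f) (k : ℕ) :
    LevelLE (L + 2 * k) ((G ^ k) f) := by
  induction k with
  | zero => simpa using hf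
  | succ k ih =>
    rw [pow_succ', Module.End.mul_apply]
    exact hG.levelLE_apply ih

/-- With the `ℓ¹` norm an operator bound only has to be checked on basis vectors, and it still
dominates the Hilbert norm by `norm_toFock2_le`. -/
theorem ellOne_apply_le (hG : IsSkewLadder G c) {L : ℕ} {f : FiniteVec} (hf : LevelLE L f) :
    ellOne (G f) ≤ c * (L + 2) * ellOne f := by
  rw [end_apply_eq_sum]
  refine (ellOne_sum_le _ _).trans ?_
  rw [ellOne, Finsupp.sum, Finset.mul_sum]
  refine Finset.sum_le_sum fun p hp => ?_
  rw [ellOne_smul, mul_comm]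
  refine mul_le_mul_of_nonneg_right ((hG.bound p).trans ?_) (norm_nonneg _)
  have h : ((p.1 + p.2 : ℕ) : ℝ) ≤ L := by exact_mod_cast hf p (Finsupp.mem_support_iff.1 hp)
  push_cast at h
  exact mul_le_mul_of_nonneg_left (by linarith) hG.nonneg

/-- After `j` applications the level is at most `L + 2j`, so the next one costs `c (L + 2j + 2) ≤ 2c
(L + 1 + j)`; the product over `j < k` is an ascending factorial. -/
theorem ellOne_pow_le_ascFactorial (hG : IsSkewLadder G c) {L : ℕ} {f : FiniteVec}
    (hf : LevelLE L f) (k : ℕ) :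
    ellOne ((G ^ k) f) ≤ (2 * c) ^ k * (L + 1).ascFactorial k * ellOne f := by
  induction k with
  | zero => simp
  | succ k ih =>
    rw [pow_succ', Module.End.mul_apply]
    refine (hG.ellOne_apply_le (hG.levelLE_pow hf k)).trans ?_
    have hc := hG.nonneg
    have h1 : c * ((L + 2 * k : ℕ) + 2) ≤ 2 * c * (L + 1 + k : ℕ) := by
      push_cast
      have : 0 ≤ c * L := by positivity
      linarith
    refine (mul_le_mul h1 ih (ellOne_nonneg _) (by positivity)).trans (le_of_eq ?_)
    rw [Nat.ascFactorial_succ]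
    push_cast
    ring

/-- Analyticity of finite vectors: after division by `k!` the bound is geometric, so the exponential
series converges for `4c|t| < 1`, a radius independent of `f`. The powers of 2 come from `choose (L
+ k) k ≤ 2 ^ (L + k)`. -/
theorem ellOne_pow_le (hG : IsSkewLadder G c) {L : ℕ} {f : FiniteVec} (hf : LevelLE L f) (k : ℕ) :
    ellOne ((G ^ k) f) ≤ 2 ^ L * ellOne f * ((4 * c) ^ k * k.factorial) := by
  refine (hG.ellOne_pow_le_ascFactorial hf k).trans ?_
  have hc := hG.nonneg
  have h : ((L + 1).ascFactorial k : ℝ) ≤ k.factorial * 2 ^ (L + k) := by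
    rw [Nat.ascFactorial_eq_factorial_mul_choose]
    exact_mod_cast Nat.mul_le_mul_left _ (Nat.choose_le_two_pow _ _)
  have h0 := ellOne_nonneg f
  calc (2 * c) ^ k * (L + 1).ascFactorial k * ellOne f
      ≤ (2 * c) ^ k * (k.factorial * 2 ^ (L + k)) * ellOne f := by gcongr
    _ = 2 ^ L * ellOne f * ((4 * c) ^ k * k.factorial) := by
      rw [show (4 : ℝ) * c = 2 * (2 * c) by ring, mul_pow 2 (2 * c), pow_add]
      ring

/-! ### Uniqueness of weak solutions -/

/-- Taylor's bound at `s`: differentiating the pairing with `f` gives minus the pairing with `G f`,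
and all these pairings vanish at `s`. Each induction step integrates the bound for `G f` once. -/
theorem norm_inner_le_taylor {δ : ℝ → Fock2} {M : ℝ} (hM : ∀ t, ‖δ t‖ ≤ M) {s : ℝ} (hs : δ s = 0)
    (hd : ∀ (f : FiniteVec) (t : ℝ), HasDerivAt (fun t => ⟪toFock2 f, δ t⟫_ℂ)
      (-⟪toFock2 (G f), δ t⟫_ℂ) t) (k : ℕ) (f : FiniteVec) {t : ℝ} (ht : s ≤ t) :
    ‖⟪toFock2 f, δ t⟫_ℂ‖ ≤ ellOne ((G ^ k) f) * M * ((t - s) ^ k / k.factorial) := by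
  induction k generalizing f t with
  | zero =>
    simp only [pow_zero, Module.End.one_apply, Nat.factorial_zero, Nat.cast_one, div_one, mul_one]
    exact (norm_inner_le_norm _ _).trans
      (mul_le_mul (norm_toFock2_le f) (hM t) (norm_nonneg _) (ellOne_nonneg f))
  | succ k ih =>
    refine image_norm_le_of_norm_deriv_right_le_deriv_boundary (a := s) (b := t)
      (f := fun t => ⟪toFock2 f, δ t⟫_ℂ) (f' := fun t => -⟪toFock2 (G f), δ t⟫_ℂ)
      (B := fun t => ellOne ((G ^ (k + 1)) f) * M * ((t - s) ^ (k + 1) / (k + 1).factorial))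
      (B' := fun t => ellOne ((G ^ (k + 1)) f) * M * ((t - s) ^ k / k.factorial))
      (fun x _ => (hd f x).continuousAt.continuousWithinAt)
      (fun x _ => (hd f x).hasDerivWithinAt) ?_ ?_ ?_ ⟨ht, le_rfl⟩
    · simp [hs]
    · intro x
      have h := ((((hasDerivAt_id x).sub_const s).pow (k + 1)).div_const
        ((k + 1).factorial : ℝ)).const_mul (ellOne ((G ^ (k + 1)) f) * M)
      refine h.congr_deriv ?_
      have : (k.factorial : ℝ) ≠ 0 := by positivity
      simp only [Nat.factorial_succ, id, Nat.add_sub_cancel]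
      push_cast
      field_simp
    · intro x hx
      rw [norm_neg, pow_succ, Module.End.mul_apply]
      exact ih (G f) hx.1

/-- Within the radius of analyticity the Taylor bound is a constant times `(4c(t - s))ᵏ` and tends
to 0. As the radius does not depend on `f`, finitely many such steps reach any time. -/
theorem eq_zero_step (hG : IsSkewLadder G c) {δ : ℝ → Fock2} {M : ℝ} (hM : ∀ t, ‖δ t‖ ≤ M)
    {s : ℝ} (hs : δ s = 0)
    (hd : ∀ (f : FiniteVec) (t : ℝ), HasDerivAt (fun t => ⟪toFock2 f, δ t⟫_ℂ)
      (-⟪toFock2 (G f), δ t⟫_ℂ) t) {t : ℝ} (ht : s ≤ t) (hts : 4 * c * (t - s) < 1) :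
    δ t = 0 := by
  have key : ∀ f, ⟪toFock2 f, δ t⟫_ℂ = 0 := by
    intro f
    obtain ⟨L, hL⟩ := exists_levelLE f
    have hM0 : 0 ≤ M := (norm_nonneg _).trans (hM 0)
    have hc := hG.nonneg
    have h : ∀ k : ℕ, ‖⟪toFock2 f, δ t⟫_ℂ‖ ≤ 2 ^ L * ellOne f * M * (4 * c * (t - s)) ^ k := by
      intro k
      refine (norm_inner_le_taylor hM hs hd k f ht).trans ?_
      have h1 := hG.ellOne_pow_le hL k
      have h2 : 0 ≤ (t - s) ^ k / k.factorial :=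
        div_nonneg (pow_nonneg (sub_nonneg.2 ht) _) (by positivity)
      refine (mul_le_mul_of_nonneg_right (mul_le_mul_of_nonneg_right h1 hM0) h2).trans
        (le_of_eq ?_)
      have : (k.factorial : ℝ) ≠ 0 := by positivity
      rw [mul_pow (4 * c)]
      field_simp
    have h3 := (tendsto_pow_atTop_nhds_zero_of_lt_one
      (mul_nonneg (by positivity) (sub_nonneg.2 ht)) hts).const_mul (2 ^ L * ellOne f * M)
    rw [mul_zero] at h3
    exact norm_le_zero_iff.1 (ge_of_tendsto' h3 h)
  have h : (fun x : Fock2 => ⟪x, δ t⟫_ℂ) = fun _ => 0 :=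
    denseRange_toFock2.equalizer (by fun_prop) continuous_const (funext key)
  exact inner_self_eq_zero.1 (congrFun h (δ t))

theorem eq_zero_of_nonneg (hG : IsSkewLadder G c) {δ : ℝ → Fock2} {M : ℝ} (hM : ∀ t, ‖δ t‖ ≤ M)
    (h0 : δ 0 = 0)
    (hd : ∀ (f : FiniteVec) (t : ℝ), HasDerivAt (fun t => ⟪toFock2 f, δ t⟫_ℂ)
      (-⟪toFock2 (G f), δ t⟫_ℂ) t) {t : ℝ} (ht : 0 ≤ t) : δ t = 0 := by
  have hc := hG.nonneg
  obtain ⟨n, hn⟩ := exists_nat_gt (4 * c * t)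
  have hn0 : (0 : ℝ) < n := lt_of_le_of_lt (by positivity) hn
  have h : ∀ k : ℕ, δ (k * (t / n)) = 0 := by
    intro k
    induction k with
    | zero => simpa using h0
    | succ k ih =>
      refine hG.eq_zero_step hM ih hd ?_ ?_
      · have : 0 ≤ t / n := by positivity
        push_cast
        linarith
      · push_cast
        rw [show 4 * c * ((k + 1) * (t / n) - k * (t / n)) = 4 * c * t / n by ring]
        rwa [div_lt_one hn0]
  have h2 := h n
  rwa [mul_div_cancel₀ _ hn0.ne'] at h2

/-- Bounded weak solutions of `δ' = G δ` with zero initial value vanish. -/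
theorem eq_zero_of_weak_solution (hG : IsSkewLadder G c) {δ : ℝ → Fock2} {M : ℝ}
    (hM : ∀ t, ‖δ t‖ ≤ M) (h0 : δ 0 = 0)
    (hd : ∀ (f : FiniteVec) (t : ℝ), HasDerivAt (fun t => ⟪toFock2 f, δ t⟫_ℂ)
      (-⟪toFock2 (G f), δ t⟫_ℂ) t) (t : ℝ) : δ t = 0 := by
  rcases le_total 0 t with ht | ht
  · exact hG.eq_zero_of_nonneg hM h0 hd ht
  -- Time reversal: `t ↦ δ (-t)` is a weak solution for `-G`.
  · have h := hG.neg.eq_zero_of_nonneg (δ := fun t => δ (-t)) (M := M) (fun t => hM _)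
      (by simpa using h0) (fun f t => by
        have h := (hd f (-t)).scomp t (hasDerivAt_neg t)
        refine h.congr_deriv ?_
        simp) (t := -t) (by linarith)
    simpa using h

end IsSkewLadder

/-- The properties of the one-parameter group in `IsUnitaryExp`. -/
structure IsUnitaryGroup (G : Module.End ℂ FiniteVec) (V : ℝ → Fock2 →L[ℂ] Fock2) : Prop where
  zero : V 0 = 1
  add : ∀ s t, V (s + t) = V s * V t
  mem_unitary : ∀ t, V t ∈ unitary (Fock2 →L[ℂ] Fock2)
  continuous : ∀ x, Continuous fun t => V t x
  hasDerivAt : ∀ f : FiniteVec, HasDerivAt (fun t => V t (toFock2 f)) (toFock2 (G f)) 0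

theorem isUnitaryExp_iff {G : Module.End ℂ FiniteVec} {U : Fock2 →L[ℂ] Fock2} :
    IsUnitaryExp G U ↔ ∃ V, IsUnitaryGroup G V ∧ U = V 1 := by
  constructor
  · rintro ⟨V, h0, h1, h2, h3, h4, h5⟩
    exact ⟨V, ⟨h0, h1, h2, h3, h4⟩, h5⟩
  · rintro ⟨V, ⟨h0, h1, h2, h3, h4⟩, h5⟩
    exact ⟨V, h0, h1, h2, h3, h4, h5⟩

namespace IsUnitaryGroup

variable {G : Module.End ℂ FiniteVec} {c : ℝ} {V : ℝ → Fock2 →L[ℂ] Fock2}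

theorem star_eq (hV : IsUnitaryGroup G V) (t : ℝ) : star (V t) = V (-t) := by
  have h : V (-t) * V t = 1 := by rw [← hV.add, neg_add_cancel, hV.zero]
  calc star (V t) = (V (-t) * V t) * star (V t) := by rw [h, one_mul]
    _ = V (-t) := by rw [mul_assoc, Unitary.mul_star_self_of_mem (hV.mem_unitary t), mul_one]

theorem inner_eq (hV : IsUnitaryGroup G V) (t : ℝ) (x y : Fock2) :
    ⟪x, V t y⟫_ℂ = ⟪V (-t) x, y⟫_ℂ := by
  rw [← hV.star_eq t, ContinuousLinearMap.star_eq_adjoint, ContinuousLinearMap.adjoint_inner_left]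

theorem norm_apply (hV : IsUnitaryGroup G V) (t : ℝ) (x : Fock2) : ‖V t x‖ = ‖x‖ :=
  ContinuousLinearMap.norm_map_of_mem_unitary (hV.mem_unitary t) x

/-- The orbit of an arbitrary vector is a weak solution. Writing `⟪f, V s x⟫ = ⟪V (-t) (V (t - s)
f), x⟫` with `t` frozen moves the derivative at `s = t` onto the finite vector `f` at time 0, where
it is given. -/
theorem hasDerivAt_inner (hV : IsUnitaryGroup G V) (f : FiniteVec) (x : Fock2) (t : ℝ) :
    HasDerivAt (fun t => ⟪toFock2 f, V t x⟫_ℂ) (-⟪toFock2 (G f), V t x⟫_ℂ) t := by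
  have h1 : HasDerivAt (fun s : ℝ => t - s) (-1) t := by
    simpa using (hasDerivAt_id t).const_sub t
  have h2 : HasDerivAt (fun s => V (t - s) (toFock2 f)) (-toFock2 (G f)) t := by
    have h := HasDerivAt.scomp (h := fun s : ℝ => t - s) t
      (by simpa using hV.hasDerivAt f) h1
    simpa [Function.comp_def] using h
  have h3 : HasDerivAt (fun s => V (-t) (V (t - s) (toFock2 f))) (V (-t) (-toFock2 (G f))) t :=
    ((V (-t)).restrictScalars ℝ).hasFDerivAt.comp_hasDerivAt t h2
  have h4 := h3.inner ℂ (hasDerivAt_const t x)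
  have h5 : (fun t => ⟪toFock2 f, V t x⟫_ℂ) =
      fun s => ⟪V (-t) (V (t - s) (toFock2 f)), x⟫_ℂ := by
    funext s
    rw [hV.inner_eq, ← mul_apply_eq_comp, ← hV.add]
    congr 3
    ring
  rw [h5]
  refine h4.congr_deriv ?_
  rw [inner_zero_right, zero_add, map_neg, inner_neg_left, hV.inner_eq]

/-- A bounded weak solution is the orbit of its initial value. -/
theorem apply_eq_of_weak_solution (hG : IsSkewLadder G c) (hV : IsUnitaryGroup G V)
    {ψ : ℝ → Fock2} {M : ℝ} (hM : ∀ t, ‖ψ t‖ ≤ M)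
    (hd : ∀ (f : FiniteVec) (t : ℝ), HasDerivAt (fun t => ⟪toFock2 f, ψ t⟫_ℂ)
      (-⟪toFock2 (G f), ψ t⟫_ℂ) t) (t : ℝ) : V t (ψ 0) = ψ t := by
  refine sub_eq_zero.1 (hG.eq_zero_of_weak_solution (δ := fun t => V t (ψ 0) - ψ t)
    (M := M + M) (fun t => ?_) (by simp [hV.zero]) (fun f t => ?_) t)
  · refine (norm_sub_le _ _).trans (add_le_add ?_ (hM t))
    rw [hV.norm_apply]
    exact hM 0
  · simp only [inner_sub_right]
    refine ((hV.hasDerivAt_inner f (ψ 0) t).sub (hd f t)).congr_deriv ?_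
    ring

theorem unique (hG : IsSkewLadder G c) (hV : IsUnitaryGroup G V) {W : ℝ → Fock2 →L[ℂ] Fock2}
    (hW : IsUnitaryGroup G W) (t : ℝ) : V t = W t := by
  ext1 x
  have h := apply_eq_of_weak_solution hG hV (ψ := fun t => W t x) (M := ‖x‖)
    (fun t => (hW.norm_apply t x).le) (fun f t => hW.hasDerivAt_inner f x t) t
  simpa [hW.zero] using h

end IsUnitaryGroup

/-! ### Existence of the unitary group -/

/-- The compression of `G` to the states of total number at most `N`. -/
def compress (G : Module.End ℂ FiniteVec) (N : ℕ) : Module.End ℂ FiniteVec :=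
  Finsupp.linearCombination ℂ fun p =>
    if p.1 + p.2 ≤ N then (G (Finsupp.single p 1)).filter (fun q => q.1 + q.2 ≤ N) else 0

theorem compress_single_apply (G : Module.End ℂ FiniteVec) (N : ℕ) (p q : ℕ × ℕ) :
    compress G N (Finsupp.single p 1) q =
      if p.1 + p.2 ≤ N ∧ q.1 + q.2 ≤ N then G (Finsupp.single p 1) q else 0 := by
  rw [compress, Finsupp.linearCombination_single, one_smul]
  by_cases hp : p.1 + p.2 ≤ N
  · by_cases hq : q.1 + q.2 ≤ N
    · simp [hp, hq]
    · simp [hp, hq]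
  · simp [hp]

theorem IsSkewLadder.compress {G : Module.End ℂ FiniteVec} {c : ℝ} (hG : IsSkewLadder G c)
    (N : ℕ) : IsSkewLadder (compress G N) c where
  skew p q := by
    rw [compress_single_apply, compress_single_apply]
    by_cases hp : p.1 + p.2 ≤ N <;> by_cases hq : q.1 + q.2 ≤ N <;> simp [hp, hq, hG.skew p q]
  bound p := by
    refine le_trans ?_ (hG.bound p)
    have h : (BosonicChannels.compress G N (Finsupp.single p 1)).support ⊆
        (G (Finsupp.single p 1)).support := by
      intro q hq
      rw [Finsupp.mem_support_iff, compress_single_apply] at hq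
      exact Finsupp.mem_support_iff.2 fun h => hq (by simp [h])
    rw [ellOne_eq_sum h, ellOne_eq_sum subset_rfl]
    refine Finset.sum_le_sum fun q _ => ?_
    rw [compress_single_apply]
    split_ifs
    · exact le_rfl
    · simp
  level p q h := by
    rw [compress_single_apply] at h
    exact hG.level p q fun h' => h (by simp [h'])

theorem compress_eq {G : Module.End ℂ FiniteVec} {c : ℝ} (hG : IsSkewLadder G c) {L N : ℕ}
    {f : FiniteVec} (hf : LevelLE L f) (hN : L + 2 ≤ N) : compress G N f = G f := by
  rw [end_apply_eq_sum, end_apply_eq_sum G]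
  refine Finset.sum_congr rfl fun p hp => ?_
  congr 1
  ext q
  rw [compress_single_apply]
  have h1 := hf p (Finsupp.mem_support_iff.1 hp)
  by_cases h : G (Finsupp.single p 1) q = 0
  · simp [h]
  · have h2 := hG.level p q h
    rw [if_pos ⟨by omega, by omega⟩]

/-- Each application raises the level by at most 2, so a cut-off at `N ≥ L + 2k` is not felt by the
first `k` powers. -/
theorem compress_pow_eq {G : Module.End ℂ FiniteVec} {c : ℝ} (hG : IsSkewLadder G c) {L N : ℕ}
    {f : FiniteVec} (hf : LevelLE L f) {k : ℕ} (hN : L + 2 * k ≤ N) :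
    (compress G N ^ k) f = (G ^ k) f := by
  induction k with
  | zero => simp
  | succ k ih =>
    rw [pow_succ', pow_succ', Module.End.mul_apply, Module.End.mul_apply, ih (by omega)]
    exact compress_eq hG (hG.levelLE_pow hf k) (by omega)

theorem finite_level (N : ℕ) : {p : ℕ × ℕ | p.1 + p.2 ≤ N}.Finite :=
  ((Set.finite_Iic N).prod (Set.finite_Iic N)).subset fun p (hp : p.1 + p.2 ≤ N) =>
    ⟨show p.1 ≤ N by omega, show p.2 ≤ N by omega⟩

/-- The bounded extension of `compress G N`. -/
def compressCLM (G : Module.End ℂ FiniteVec) (N : ℕ) : Fock2 →L[ℂ] Fock2 :=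
  ∑ p ∈ (finite_level N).toFinset,
    InnerProductSpace.rankOne ℂ (toFock2 (compress G N (Finsupp.single p 1))) (ket p)

theorem compressCLM_toFock2 (G : Module.End ℂ FiniteVec) (N : ℕ) (f : FiniteVec) :
    compressCLM G N (toFock2 f) = toFock2 (compress G N f) := by
  induction f using Finsupp.induction_linear with
  | zero => simp
  | add f g hf hg => simp [hf, hg]
  | single q a =>
    rw [show Finsupp.single q a = a • Finsupp.single q (1 : ℂ) by simp, map_smul, map_smul,
      map_smul, map_smul]
    congr 1
    rw [toFock2_single, one_smul, compressCLM, sum_apply]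
    simp only [InnerProductSpace.rankOne_apply, inner_ket_left, ket_apply, ite_smul, one_smul,
      zero_smul, Finset.sum_ite_eq', Set.Finite.mem_toFinset, Set.mem_ofPred_eq]
    split_ifs with h
    · rfl
    · symm
      convert map_zero toFock2
      ext p
      simp [compress_single_apply, h]

theorem compressCLM_pow_toFock2 (G : Module.End ℂ FiniteVec) (N k : ℕ) (f : FiniteVec) :
    (compressCLM G N ^ k) (toFock2 f) = toFock2 ((compress G N ^ k) f) := by
  induction k with
  | zero => simp
  | succ k ih =>
    rw [pow_succ', pow_succ', Module.End.mul_apply, mul_apply_eq_comp, ih, compressCLM_toFock2]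

theorem star_compressCLM {G : Module.End ℂ FiniteVec} {c : ℝ} (hG : IsSkewLadder G c) (N : ℕ) :
    star (compressCLM G N) = -compressCLM G N := by
  have hd : Dense (Submodule.span ℂ (Set.range (ketBasis (ℕ × ℕ))) : Set Fock2) :=
    Submodule.dense_iff_topologicalClosure_eq_top.2 (ketBasis (ℕ × ℕ)).dense_span
  refine ContinuousLinearMap.ext_on hd ?_
  rintro _ ⟨p, rfl⟩
  rw [ketBasis_apply]
  ext q
  have h : ∀ p : ℕ × ℕ, ket p = toFock2 (Finsupp.single p 1) := fun p => by
    rw [toFock2_single, one_smul]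
  rw [← inner_ket_left, ContinuousLinearMap.star_eq_adjoint,
    ContinuousLinearMap.adjoint_inner_right, inner_ket_right, h q, compressCLM_toFock2,
    toFock2_apply, (hG.compress N).skew, h p, neg_apply, compressCLM_toFock2,
    lp.coeFn_neg, Pi.neg_apply, toFock2_apply]
  simp

/-- The unitary group generated by the compression of `G`. -/
def compressExp (G : Module.End ℂ FiniteVec) (N : ℕ) (t : ℝ) : Fock2 →L[ℂ] Fock2 :=
  NormedSpace.exp ((t : ℂ) • compressCLM G N)

theorem compressExp_zero (G : Module.End ℂ FiniteVec) (N : ℕ) : compressExp G N 0 = 1 := by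
  simp [compressExp, NormedSpace.exp_zero]

theorem compressExp_add (G : Module.End ℂ FiniteVec) (N : ℕ) (s t : ℝ) :
    compressExp G N (s + t) = compressExp G N s * compressExp G N t := by
  let : NormedAlgebra ℚ (Fock2 →L[ℂ] Fock2) := NormedAlgebra.restrictScalars ℚ ℂ _
  rw [compressExp, compressExp, compressExp, ← NormedSpace.exp_add_of_commute, ← add_smul]
  · push_cast
    rfl
  · exact ((Commute.refl _).smul_left _).smul_right _

theorem star_compressExp {G : Module.End ℂ FiniteVec} {c : ℝ} (hG : IsSkewLadder G c) (N : ℕ)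
    (t : ℝ) : star (compressExp G N t) = compressExp G N (-t) := by
  rw [compressExp, compressExp, NormedSpace.star_exp, star_smul, star_compressCLM hG]
  simp

theorem norm_compressExp_apply {G : Module.End ℂ FiniteVec} {c : ℝ} (hG : IsSkewLadder G c)
    (N : ℕ) (t : ℝ) (x : Fock2) : ‖compressExp G N t x‖ = ‖x‖ := by
  refine ContinuousLinearMap.norm_map_of_mem_unitary (Unitary.mem_iff.2 ⟨?_, ?_⟩) x
  · rw [star_compressExp hG, ← compressExp_add, neg_add_cancel, compressExp_zero]
  · rw [star_compressExp hG, ← compressExp_add, add_neg_cancel, compressExp_zero]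

theorem hasSum_compressExp (G : Module.End ℂ FiniteVec) (N : ℕ) (t : ℝ) (f : FiniteVec) :
    HasSum (fun k : ℕ => ((t : ℂ) ^ k / k.factorial) • toFock2 ((compress G N ^ k) f))
      (compressExp G N t (toFock2 f)) := by
  let : NormedAlgebra ℚ (Fock2 →L[ℂ] Fock2) := NormedAlgebra.restrictScalars ℚ ℂ _
  have h := NormedSpace.exp_series_hasSum_exp' (𝕂 := ℂ) ((t : ℂ) • compressCLM G N)
  have h2 := h.mapL (ContinuousLinearMap.apply ℂ Fock2 (toFock2 f))
  simp only [smul_pow, ContinuousLinearMap.apply_apply, smul_apply,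
    compressCLM_pow_toFock2, smul_smul] at h2
  refine h2.congr_fun fun k => ?_
  rw [div_eq_inv_mul]

theorem norm_term_le {G : Module.End ℂ FiniteVec} {c : ℝ} (hG : IsSkewLadder G c) {L : ℕ}
    {f : FiniteVec} (hf : LevelLE L f) (t : ℝ) (k : ℕ) :
    ‖((t : ℂ) ^ k / k.factorial) • toFock2 ((G ^ k) f)‖ ≤
      2 ^ L * ellOne f * (4 * c * |t|) ^ k := by
  rw [norm_smul, norm_div, norm_pow, Complex.norm_real, Complex.norm_natCast, Real.norm_eq_abs]
  have h := (norm_toFock2_le _).trans (hG.ellOne_pow_le hf k)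
  refine (mul_le_mul_of_nonneg_left h (by positivity)).trans (le_of_eq ?_)
  have : (k.factorial : ℝ) ≠ 0 := by positivity
  rw [mul_pow (4 * c)]
  field_simp

theorem summable_term_bound {c : ℝ} (hc : 0 ≤ c) (C : ℝ) {t : ℝ} (ht : 4 * c * |t| < 1) :
    Summable fun k : ℕ => C * (4 * c * |t|) ^ k :=
  (summable_geometric_of_lt_one (by positivity) ht).mul_left C

/-- Each term of the exponential series is eventually constant in `N`, and all truncations share the
constant `c`, hence one geometric majorant. -/
theorem tendsto_compressExp_toFock2 {G : Module.End ℂ FiniteVec} {c : ℝ} (hG : IsSkewLadder G c)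
    {t : ℝ} (ht : 4 * c * |t| < 1) (f : FiniteVec) :
    Tendsto (fun N => compressExp G N t (toFock2 f)) atTop
      (𝓝 (∑' k : ℕ, ((t : ℂ) ^ k / k.factorial) • toFock2 ((G ^ k) f))) := by
  obtain ⟨L, hL⟩ := exists_levelLE f
  simp only [← fun N => (hasSum_compressExp G N t f).tsum_eq]
  refine tendsto_tsum_of_dominated_convergence
    (summable_term_bound hG.nonneg (2 ^ L * ellOne f) ht) (fun k => ?_) ?_
  · refine tendsto_const_nhds.congr' ?_
    filter_upwards [eventually_ge_atTop (L + 2 * k)] with N hN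
    rw [compress_pow_eq hG hL hN]
  · filter_upwards with N k
    exact norm_term_le (hG.compress N) hL t k

theorem exists_tendsto_of_dense {A : ℕ → Fock2 →L[ℂ] Fock2} (hA : ∀ N x, ‖A N x‖ = ‖x‖)
    {s : Set Fock2} (hs : Dense s) (h : ∀ x ∈ s, ∃ y, Tendsto (fun N => A N x) atTop (𝓝 y))
    (x : Fock2) : ∃ y, Tendsto (fun N => A N x) atTop (𝓝 y) := by
  refine cauchySeq_tendsto_of_complete (Metric.cauchySeq_iff'.2 fun ε hε => ?_)
  obtain ⟨z, hz, hxz⟩ := Metric.mem_closure_iff.1 (hs x) (ε / 3) (by positivity)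
  obtain ⟨y, hy⟩ := h z hz
  obtain ⟨N, hN⟩ := Metric.cauchySeq_iff'.1 hy.cauchySeq (ε / 3) (by positivity)
  refine ⟨N, fun n hn => ?_⟩
  have h1 : ∀ k, dist (A k x) (A k z) = dist x z := fun k => by
    rw [dist_eq_norm, dist_eq_norm, ← map_sub, hA]
  have h2 := dist_triangle4 (A n x) (A n z) (A N z) (A N x)
  rw [h1, dist_comm (A N z), h1] at h2
  have h3 := hN n hn
  linarith

/-- Short times follow from the series on a dense set and isometry. A long time is split into `n`
short ones, isometry carrying the error of one step through the next. -/
theorem exists_tendsto_compressExp {G : Module.End ℂ FiniteVec} {c : ℝ} (hG : IsSkewLadder G c)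
    (t : ℝ) (x : Fock2) : ∃ y, Tendsto (fun N => compressExp G N t x) atTop (𝓝 y) := by
  have hc := hG.nonneg
  obtain ⟨n, hn⟩ := exists_nat_gt (4 * c * |t|)
  have hn0 : (0 : ℝ) < n := lt_of_le_of_lt (by positivity) hn
  have hsmall : 4 * c * |t / n| < 1 := by
    rw [abs_div, Nat.abs_cast, ← mul_div_assoc]
    exact (div_lt_one hn0).2 hn
  have h : ∀ (k : ℕ) x, ∃ y, Tendsto (fun N => compressExp G N (k * (t / n)) x) atTop (𝓝 y) := by
    intro k
    induction k with
    | zero =>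
      intro x
      exact ⟨x, by simp [compressExp_zero]⟩
    | succ k ih =>
      intro x
      obtain ⟨y, hy⟩ := ih x
      obtain ⟨z, hz⟩ := exists_tendsto_of_dense
        (fun N x => norm_compressExp_apply hG N (t / n) x) denseRange_toFock2
        (by rintro _ ⟨f, rfl⟩; exact ⟨_, tendsto_compressExp_toFock2 hG hsmall f⟩) y
      refine ⟨z, ?_⟩
      have h1 : Tendsto (fun N => compressExp G N (t / n) (compressExp G N (k * (t / n)) x - y))
          atTop (𝓝 0) := by
        refine tendsto_zero_iff_norm_tendsto_zero.2 ?_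
        simp only [norm_compressExp_apply hG]
        exact tendsto_zero_iff_norm_tendsto_zero.1 (tendsto_sub_nhds_zero_iff.2 hy)
      have h2 := h1.add hz
      rw [zero_add] at h2
      refine h2.congr fun N => ?_
      rw [map_sub, sub_add_cancel, ← mul_apply_eq_comp, ← compressExp_add]
      congr 2
      push_cast
      ring
  have h2 := h n x
  rwa [mul_div_cancel₀ _ hn0.ne'] at h2

/-- The quadratic remainder of the exponential series; it yields the derivative of the limit group
at 0. -/
theorem norm_tsum_sub_le {G : Module.End ℂ FiniteVec} {c : ℝ} (hG : IsSkewLadder G c) {L : ℕ}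
    {f : FiniteVec} (hf : LevelLE L f) {t : ℝ} (ht : 4 * c * |t| ≤ 1 / 2) :
    ‖(∑' k : ℕ, ((t : ℂ) ^ k / k.factorial) • toFock2 ((G ^ k) f)) - toFock2 f -
      t • toFock2 (G f)‖ ≤ 2 ^ L * ellOne f * (2 * (4 * c * |t|) ^ 2) := by
  have hc := hG.nonneg
  set C := 2 ^ L * ellOne f
  set a : ℕ → Fock2 := fun k => ((t : ℂ) ^ k / k.factorial) • toFock2 ((G ^ k) f)
  have hb := summable_term_bound hc C (t := t) (by linarith)
  have ha : Summable a := Summable.of_norm_bounded hb fun k => norm_term_le hG hf t k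
  have h1 : (∑' k, a k) - toFock2 f - t • toFock2 (G f) = ∑' k, a (k + 2) := by
    rw [← ha.sum_add_tsum_nat_add 2]
    have h0 : a 0 = toFock2 f := by simp [a]
    have h1 : a 1 = t • toFock2 (G f) := by
      simp only [a, pow_one, Nat.factorial_one, Nat.cast_one, div_one]
      rfl
    rw [Finset.sum_range_succ, Finset.sum_range_one, h0, h1]
    abel
  have h2 : HasSum (fun k : ℕ => C * (4 * c * |t|) ^ 2 * (4 * c * |t|) ^ k)
      (C * (4 * c * |t|) ^ 2 * (1 - 4 * c * |t|)⁻¹) :=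
    (hasSum_geometric_of_lt_one (by positivity) (by linarith)).mul_left _
  rw [h1]
  refine (tsum_of_norm_bounded h2 fun k => ?_).trans ?_
  · refine (norm_term_le hG hf t (k + 2)).trans (le_of_eq ?_)
    ring
  · have h3 : (1 - 4 * c * |t|)⁻¹ ≤ 2 := by
      rw [inv_le_comm₀ (by linarith) (by norm_num)]
      linarith
    have h4 : 0 ≤ C * (4 * c * |t|) ^ 2 :=
      mul_nonneg (mul_nonneg (by positivity) (ellOne_nonneg f)) (by positivity)
    calc _ ≤ C * (4 * c * |t|) ^ 2 * 2 := mul_le_mul_of_nonneg_left h3 h4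
      _ = _ := by ring

/-- A skew ladder operator generates a unitary group. -/
theorem exists_isUnitaryGroup {G : Module.End ℂ FiniteVec} {c : ℝ} (hG : IsSkewLadder G c) :
    ∃ V, IsUnitaryGroup G V := by
  have hc := hG.nonneg
  choose W hW using exists_tendsto_compressExp hG
  let V : ℝ → Fock2 →L[ℂ] Fock2 := fun t =>
    continuousLinearMapOfTendsto (fun N => compressExp G N t) (tendsto_pi_nhds.2 (hW t))
  have hV : ∀ t x, Tendsto (fun N => compressExp G N t x) atTop (𝓝 (V t x)) := hW
  have hnorm : ∀ t x, ‖V t x‖ = ‖x‖ := fun t x =>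
    tendsto_nhds_unique (hV t x).norm
      (by simp only [norm_compressExp_apply hG]; exact tendsto_const_nhds)
  have h0 : V 0 = 1 := by
    ext1 x
    exact tendsto_nhds_unique (hV 0 x) (by simp [compressExp_zero])
  have hadd : ∀ s t, V (s + t) = V s * V t := by
    intro s t
    ext1 x
    refine tendsto_nhds_unique (hV (s + t) x) ?_
    have h1 : Tendsto (fun N => compressExp G N s (compressExp G N t x - V t x))
        atTop (𝓝 0) := by
      refine tendsto_zero_iff_norm_tendsto_zero.2 ?_
      simp only [norm_compressExp_apply hG]
      exact tendsto_zero_iff_norm_tendsto_zero.1 (tendsto_sub_nhds_zero_iff.2 (hV t x))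
    have h2 := h1.add (hV s (V t x))
    rw [zero_add] at h2
    refine h2.congr fun N => ?_
    rw [map_sub, sub_add_cancel, ← mul_apply_eq_comp, ← compressExp_add]
  have hstar : ∀ t, star (V t) = V (-t) := by
    intro t
    ext1 x
    refine ext_inner_left ℂ fun y => ?_
    rw [ContinuousLinearMap.star_eq_adjoint, ContinuousLinearMap.adjoint_inner_right]
    refine tendsto_nhds_unique ((hV t y).inner tendsto_const_nhds)
      (((tendsto_const_nhds (x := y)).inner (hV (-t) x)).congr fun N => ?_)
    rw [← star_compressExp hG, ContinuousLinearMap.star_eq_adjoint,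
      ContinuousLinearMap.adjoint_inner_right]
  have hunit : ∀ t, V t ∈ unitary (Fock2 →L[ℂ] Fock2) := fun t => by
    rw [Unitary.mem_iff, hstar, ← hadd, ← hadd, neg_add_cancel, add_neg_cancel, h0]
    exact ⟨rfl, rfl⟩
  have hderiv : ∀ f : FiniteVec,
      HasDerivAt (fun t => V t (toFock2 f)) (toFock2 (G f)) 0 := by
    intro f
    obtain ⟨L, hL⟩ := exists_levelLE f
    rw [hasDerivAt_iff_isLittleO_nhds_zero]
    have hO : (fun h : ℝ => V (0 + h) (toFock2 f) - V 0 (toFock2 f) - h • toFock2 (G f))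
        =O[𝓝 0] fun h : ℝ => h ^ 2 := by
      refine Asymptotics.IsBigO.of_bound (2 ^ L * ellOne f * (2 * (4 * c) ^ 2)) ?_
      have hev : ∀ᶠ t : ℝ in 𝓝 0, 4 * c * |t| < 1 / 2 := by
        have hcont : Continuous fun t : ℝ => 4 * c * |t| := by fun_prop
        exact hcont.continuousAt.eventually_lt continuousAt_const (by simp)
      filter_upwards [hev] with t ht
      have h1 : V t (toFock2 f) = ∑' k : ℕ, ((t : ℂ) ^ k / k.factorial) • toFock2 ((G ^ k) f) :=
        tendsto_nhds_unique (hV t _) (tendsto_compressExp_toFock2 hG (by linarith) f)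
      rw [zero_add, h1, h0, one_apply_eq_self]
      refine (norm_tsum_sub_le hG hL ht.le).trans (le_of_eq ?_)
      rw [norm_pow, Real.norm_eq_abs]
      ring
    exact hO.trans_isLittleO (by simpa using Asymptotics.isLittleO_pow_id one_lt_two)
  have hcont0 : ∀ x, ContinuousAt (fun t => V t x) 0 := by
    intro x
    rw [Metric.continuousAt_iff']
    intro ε hε
    obtain ⟨_, ⟨f, rfl⟩, hxf⟩ :=
      Metric.mem_closure_iff.1 (denseRange_toFock2 x) (ε / 3) (by positivity)
    filter_upwards [Metric.continuousAt_iff'.1 (hderiv f).continuousAt (ε / 3) (by positivity)]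
      with t ht
    have h1 : ∀ k, dist (V k x) (V k (toFock2 f)) = dist x (toFock2 f) := fun k => by
      rw [dist_eq_norm, dist_eq_norm, ← map_sub, hnorm]
    have h2 := dist_triangle4 (V t x) (V t (toFock2 f)) (V 0 (toFock2 f)) (V 0 x)
    rw [h1, dist_comm (V 0 (toFock2 f)), h1] at h2
    linarith
  have hcont : ∀ x, Continuous fun t => V t x := by
    intro x
    refine continuous_iff_continuousAt.2 fun s => ?_
    have h1 : (fun t => V t x) = (fun y => V s y) ∘ (fun t => V t x) ∘ fun t => t - s := by
      funext t
      simp only [Function.comp_apply]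
      rw [← mul_apply_eq_comp, ← hadd, add_sub_cancel]
    rw [h1]
    refine (V s).continuous.continuousAt.comp (ContinuousAt.comp ?_ (by fun_prop))
    rw [sub_self]
    exact hcont0 x
  exact ⟨V, h0, hadd, hunit, hcont, hderiv⟩

theorem existsUnique_isUnitaryExp {G : Module.End ℂ FiniteVec} {c : ℝ} (hG : IsSkewLadder G c) :
    ∃! U, IsUnitaryExp G U := by
  obtain ⟨V, hV⟩ := exists_isUnitaryGroup hG
  refine ⟨V 1, isUnitaryExp_iff.2 ⟨V, hV, rfl⟩, fun U hU => ?_⟩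
  obtain ⟨W, hW, rfl⟩ := isUnitaryExp_iff.1 hU
  exact hW.unique hG hV 1

/-- `unitaryExp` is a choice with default value 0; existence rules out the default and uniqueness
makes the choice irrelevant. -/
theorem unitaryExp_eq {G : Module.End ℂ FiniteVec} {c : ℝ} (hG : IsSkewLadder G c)
    {V : ℝ → Fock2 →L[ℂ] Fock2} (hV : IsUnitaryGroup G V) : unitaryExp G = V 1 := by
  have h : ∃ U, IsUnitaryExp G U := ⟨V 1, isUnitaryExp_iff.2 ⟨V, hV, rfl⟩⟩
  rw [unitaryExp, dif_pos h]
  exact (existsUnique_isUnitaryExp hG).unique h.choose_spec (isUnitaryExp_iff.2 ⟨V, hV, rfl⟩)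

/-! ### The squeezing and beamsplitter unitaries on states with empty ancilla -/

/-- The tool for evaluating `exp G`: guess a bounded curve and check its differential equation
coordinate by coordinate. Linearity gives the weak equation against all finite vectors. -/
theorem unitaryExp_apply_of_weak_solution {G : Module.End ℂ FiniteVec} {c : ℝ}
    (hG : IsSkewLadder G c) {ψ : ℝ → Fock2} {M : ℝ} (hM : ∀ t, ‖ψ t‖ ≤ M)
    (hd : ∀ (p : ℕ × ℕ) (t : ℝ), HasDerivAt (fun t => ψ t p)
      (-⟪toFock2 (G (Finsupp.single p 1)), ψ t⟫_ℂ) t) : unitaryExp G (ψ 0) = ψ 1 := by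
  obtain ⟨V, hV⟩ := exists_isUnitaryGroup hG
  rw [unitaryExp_eq hG hV]
  refine IsUnitaryGroup.apply_eq_of_weak_solution hG hV hM (fun f t => ?_) 1
  induction f using Finsupp.induction_linear with
  | zero => simpa using hasDerivAt_const t (0 : ℂ)
  | add f g hf hg =>
    simp only [map_add, inner_add_left]
    exact (hf.add hg).congr_deriv (by ring)
  | single p a =>
    rw [show Finsupp.single p a = a • Finsupp.single p (1 : ℂ) by simp]
    simp only [map_smul, inner_smul_left, toFock2_single, one_smul, inner_ket_left]
    exact ((hd p t).const_mul (conj a)).congr_deriv (by ring)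

/-! ### Matrix elements of the two generators -/

theorem sqrt_mul_sqrt_le {a b : ℝ} (ha : 0 ≤ a) (hb : 0 ≤ b) :
    Real.sqrt a * Real.sqrt b ≤ (a + b) / 2 := by
  have h := two_mul_le_add_sq (Real.sqrt a) (Real.sqrt b)
  rw [Real.sq_sqrt ha, Real.sq_sqrt hb] at h
  linarith

/-- The two-mode squeezing generator of angle `θ`. -/
def squeezeGen (θ : ℝ) : Module.End ℂ FiniteVec := (θ : ℂ) • (opADag * opBDag - opA * opB)

/-- The beamsplitter generator of angle `θ`. -/
def rotateGen (θ : ℝ) : Module.End ℂ FiniteVec := (θ : ℂ) • (opADag * opB - opA * opBDag)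

theorem squeezeGen_single (θ : ℝ) (p : ℕ × ℕ) : squeezeGen θ (Finsupp.single p 1) =
    Finsupp.single (p.1 + 1, p.2 + 1) ((θ * (√(p.1 + 1) * √(p.2 + 1)) : ℝ) : ℂ) +
      Finsupp.single (p.1 - 1, p.2 - 1) ((-θ * (√p.1 * √p.2) : ℝ) : ℂ) := by
  simp only [squeezeGen, opADag, opBDag, opA, opB, LinearMap.smul_apply, LinearMap.sub_apply,
    Module.End.mul_apply, Finsupp.linearCombination_single, one_smul, Finsupp.smul_single,
    smul_add, smul_eq_mul, sub_eq_add_neg, ← Finsupp.single_neg]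
  push_cast
  congr 2 <;> ring

theorem rotateGen_single (θ : ℝ) (p : ℕ × ℕ) : rotateGen θ (Finsupp.single p 1) =
    Finsupp.single (p.1 + 1, p.2 - 1) ((θ * (√(p.1 + 1) * √p.2) : ℝ) : ℂ) +
      Finsupp.single (p.1 - 1, p.2 + 1) ((-θ * (√p.1 * √(p.2 + 1)) : ℝ) : ℂ) := by
  simp only [rotateGen, opADag, opBDag, opA, opB, LinearMap.smul_apply, LinearMap.sub_apply,
    Module.End.mul_apply, Finsupp.linearCombination_single, one_smul, Finsupp.smul_single,
    smul_add, smul_eq_mul, sub_eq_add_neg, ← Finsupp.single_neg]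
  push_cast
  congr 2 <;> ring

theorem single_ofReal_apply (p q : ℕ × ℕ) (x : ℝ) :
    Finsupp.single p (x : ℂ) q = ((if p = q then x else 0 : ℝ) : ℂ) := by
  rw [Finsupp.single_apply]
  split_ifs <;> simp

/-- In this form, exchanging `p` and `q` exchanges the two terms, so skewness can be read off. -/
theorem squeezeGen_single_apply (θ : ℝ) (p q : ℕ × ℕ) : squeezeGen θ (Finsupp.single p 1) q =
    ((θ * ((if q = (p.1 + 1, p.2 + 1) then √q.1 * √q.2 else 0) -
      if p = (q.1 + 1, q.2 + 1) then √p.1 * √p.2 else 0) : ℝ) : ℂ) := by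
  rw [squeezeGen_single, Finsupp.add_apply, single_ofReal_apply, single_ofReal_apply,
    ← Complex.ofReal_add, mul_sub, sub_eq_add_neg]
  obtain ⟨a, b⟩ := p
  obtain ⟨c, d⟩ := q
  congr 2
  · by_cases h : (c, d) = (a + 1, b + 1)
    · simp only [Prod.mk.injEq] at h
      simp [h.1, h.2]
    · rw [if_neg h, if_neg fun h' => h h'.symm, mul_zero]
  · by_cases h : (a, b) = (c + 1, d + 1)
    · simp only [Prod.mk.injEq] at h
      simp [h.1, h.2]
    · rw [if_neg h]
      -- At index 0 the truncated subtraction points to a wrong state, but its coefficient contains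
      -- `√0`.
      rcases a with _ | a
      · simp
      rcases b with _ | b
      · simp
      rw [if_neg fun h' => h (by simpa using h'), mul_zero, neg_zero]

theorem rotateGen_single_apply (θ : ℝ) (p q : ℕ × ℕ) : rotateGen θ (Finsupp.single p 1) q =
    ((θ * ((if q.1 = p.1 + 1 ∧ p.2 = q.2 + 1 then √q.1 * √p.2 else 0) -
      if p.1 = q.1 + 1 ∧ q.2 = p.2 + 1 then √p.1 * √q.2 else 0) : ℝ) : ℂ) := by
  rw [rotateGen_single, Finsupp.add_apply, single_ofReal_apply, single_ofReal_apply,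
    ← Complex.ofReal_add, mul_sub, sub_eq_add_neg]
  obtain ⟨a, b⟩ := p
  obtain ⟨c, d⟩ := q
  congr 2
  · by_cases h : c = a + 1 ∧ b = d + 1
    · simp [h.1, h.2]
    · rw [if_neg h]
      rcases b with _ | b
      · simp
      rw [if_neg fun h' => h (by simp at h'; simp [h'.1, h'.2]), mul_zero]
  · by_cases h : a = c + 1 ∧ d = b + 1
    · simp [h.1, h.2]
    · rw [if_neg h]
      rcases a with _ | a
      · simp
      rw [if_neg fun h' => h (by simp at h'; simp [h'.1, h'.2]), mul_zero, neg_zero]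

theorem isSkewLadder_squeezeGen (θ : ℝ) : IsSkewLadder (squeezeGen θ) |θ| where
  skew p q := by
    rw [squeezeGen_single_apply, squeezeGen_single_apply, Complex.conj_ofReal, ← Complex.ofReal_neg]
    congr 1
    ring
  bound p := by
    rw [squeezeGen_single]
    refine (ellOne_add_le _ _).trans ?_
    simp only [ellOne_single, Complex.norm_real, Real.norm_eq_abs, abs_mul, abs_neg,
      abs_of_nonneg (Real.sqrt_nonneg _), ← mul_add]
    have h1 := sqrt_mul_sqrt_le (a := p.1 + 1) (b := p.2 + 1) (by positivity) (by positivity)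
    have h2 := sqrt_mul_sqrt_le (a := p.1) (b := p.2) (by positivity) (by positivity)
    exact mul_le_mul_of_nonneg_left (by linarith) (abs_nonneg θ)
  level p q h := by
    rw [squeezeGen_single_apply] at h
    by_contra hlt
    refine h ?_
    rw [if_neg, if_neg] <;> simp only [sub_zero, mul_zero, Complex.ofReal_zero, Prod.ext_iff] <;>
      omega

theorem isSkewLadder_rotateGen (θ : ℝ) : IsSkewLadder (rotateGen θ) |θ| where
  skew p q := by
    rw [rotateGen_single_apply, rotateGen_single_apply, Complex.conj_ofReal, ← Complex.ofReal_neg]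
    congr 1
    simp only [mul_comm √(q.1 : ℝ), mul_comm √(p.1 : ℝ)]
    ring
  bound p := by
    rw [rotateGen_single]
    refine (ellOne_add_le _ _).trans ?_
    simp only [ellOne_single, Complex.norm_real, Real.norm_eq_abs, abs_mul, abs_neg,
      abs_of_nonneg (Real.sqrt_nonneg _), ← mul_add]
    have h1 := sqrt_mul_sqrt_le (a := p.1 + 1) (b := p.2) (by positivity) (by positivity)
    have h2 := sqrt_mul_sqrt_le (a := p.1) (b := p.2 + 1) (by positivity) (by positivity)
    exact mul_le_mul_of_nonneg_left (by linarith) (abs_nonneg θ)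
  level p q h := by
    rw [rotateGen_single_apply] at h
    by_contra hlt
    refine h ?_
    rw [if_neg (by omega), if_neg (by omega), sub_zero, mul_zero, Complex.ofReal_zero]

theorem inner_toFock2_squeezeGen (θ : ℝ) (p : ℕ × ℕ) (x : Fock2) :
    ⟪toFock2 (squeezeGen θ (Finsupp.single p 1)), x⟫_ℂ =
      (θ : ℂ) * ((√(p.1 + 1) * √(p.2 + 1) : ℝ) * x (p.1 + 1, p.2 + 1) -
        (√p.1 * √p.2 : ℝ) * x (p.1 - 1, p.2 - 1)) := by
  rw [squeezeGen_single, map_add, toFock2_single, toFock2_single, inner_add_left, inner_smul_left,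
    inner_smul_left, inner_ket_left, inner_ket_left, Complex.conj_ofReal, Complex.conj_ofReal]
  push_cast
  ring

theorem inner_toFock2_rotateGen (θ : ℝ) (p : ℕ × ℕ) (x : Fock2) :
    ⟪toFock2 (rotateGen θ (Finsupp.single p 1)), x⟫_ℂ =
      (θ : ℂ) * ((√(p.1 + 1) * √p.2 : ℝ) * x (p.1 + 1, p.2 - 1) -
        (√p.1 * √(p.2 + 1) : ℝ) * x (p.1 - 1, p.2 + 1)) := by
  rw [rotateGen_single, map_add, toFock2_single, toFock2_single, inner_add_left, inner_smul_left,
    inner_smul_left, inner_ket_left, inner_ket_left, Complex.conj_ofReal, Complex.conj_ofReal]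
  push_cast
  ring

/-! ### Evolution of `|m, 0⟩` in closed form -/

theorem sqrt_succ_mul_sqrt_choose (m n : ℕ) :
    √((m + n : ℕ) + 1) * √((m + n).choose n : ℝ) = √(n + 1) * √((m + n + 1).choose (n + 1) : ℝ) := by
  rw [← Real.sqrt_mul (by positivity), ← Real.sqrt_mul (by positivity)]
  congr 1
  have h := Nat.add_one_mul_choose_eq (m + n) n
  rw [mul_comm (_ + 1 : ℝ) ((m + n + 1).choose (n + 1) : ℝ)]
  exact_mod_cast h

theorem sqrt_mul_sqrt_choose_succ (p q : ℕ) :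
    √(p + 1) * √((p + 1 + q).choose q : ℝ) = √(q + 1) * √((p + 1 + q).choose (q + 1) : ℝ) := by
  rw [← Real.sqrt_mul (by positivity), ← Real.sqrt_mul (by positivity)]
  congr 1
  have h := Nat.choose_succ_right_eq (p + 1 + q) q
  rw [Nat.add_sub_cancel] at h
  rw [mul_comm, mul_comm (_ + 1 : ℝ) ((p + 1 + q).choose (q + 1) : ℝ)]
  exact_mod_cast h.symm

/-- The coordinates of the squeezed state with `m` quanta in the system, for the angle `s`. -/
def squeezedCoeff (m : ℕ) (s : ℝ) (p : ℕ × ℕ) : ℝ :=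
  if p.1 = m + p.2 then
    √((m + p.2).choose p.2 : ℝ) * (Real.sinh s ^ p.2 / Real.cosh s ^ (m + p.2 + 1)) else 0

/-- The negative binomial series in `tanh² s`, together with `1 - tanh² s = 1 / cosh² s`. -/
theorem hasSum_squeezedCoeff_sq (m : ℕ) (s : ℝ) :
    HasSum (fun p => ‖(squeezedCoeff m s p : ℂ)‖ ^ 2) 1 := by
  have hi : Function.Injective fun n : ℕ => (m + n, n) := fun a b h => (Prod.ext_iff.1 h).2
  refine (hi.hasSum_iff ?_).1 ?_
  · intro p hp
    rw [squeezedCoeff, if_neg]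
    · simp
    · intro h
      exact hp ⟨p.2, Prod.ext h.symm rfl⟩
  · have hc := Real.cosh_pos s
    have hcs := Real.cosh_sq s
    have h1 : ‖(Real.sinh s / Real.cosh s) ^ 2‖ < 1 := by
      rw [Real.norm_of_nonneg (sq_nonneg _), div_pow, div_lt_one (by positivity)]
      linarith
    have h2 := (hasSum_choose_mul_geometric_of_norm_lt_one m h1).mul_right
      ((Real.cosh s ^ (m + 1))⁻¹ ^ 2)
    have h3 : 1 - (Real.sinh s / Real.cosh s) ^ 2 = (Real.cosh s ^ 2)⁻¹ := by
      field_simp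
      linarith
    rw [h3] at h2
    have h4 : 1 / (Real.cosh s ^ 2)⁻¹ ^ (m + 1) * (Real.cosh s ^ (m + 1))⁻¹ ^ 2 = 1 := by
      rw [inv_pow, inv_pow, one_div, inv_inv, ← pow_mul, ← pow_mul, mul_comm 2]
      exact mul_inv_cancel₀ (by positivity)
    rw [h4] at h2
    refine h2.congr_fun fun n => ?_
    rw [Function.comp_apply, squeezedCoeff, if_pos rfl, Complex.norm_real, Real.norm_eq_abs,
      sq_abs, mul_pow, Real.sq_sqrt (by positivity), add_comm n m, Nat.choose_symm_add]
    simp only [div_pow, inv_pow, ← pow_mul]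
    rw [mul_comm n 2, show (m + n + 1) * 2 = 2 * n + (m + 1) * 2 by ring, pow_add]
    field_simp

/-- The squeezed state with `m` quanta in the system, for the angle `s`. -/
def squeezed (m : ℕ) (s : ℝ) : Fock2 :=
  ⟨fun p => (squeezedCoeff m s p : ℂ), memℓp_two (hasSum_squeezedCoeff_sq m s).summable⟩

theorem squeezed_apply (m : ℕ) (s : ℝ) (p : ℕ × ℕ) :
    squeezed m s p = (squeezedCoeff m s p : ℂ) := rfl

theorem norm_squeezed (m : ℕ) (s : ℝ) : ‖squeezed m s‖ = 1 := by
  have h := lp.hasSum_norm (p := 2) (by norm_num) (squeezed m s)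
  simp only [ENNReal.toReal_ofNat, Real.rpow_ofNat] at h
  have h2 : ‖squeezed m s‖ ^ 2 = 1 := h.unique (hasSum_squeezedCoeff_sq m s)
  exact (pow_eq_one_iff_of_nonneg (norm_nonneg _) two_ne_zero).1 h2

/-- On the support, differentiating `sinhⁿ / cosh^(m+n+1)` gives `n sinh^(n-1) / cosh^(m+n) -
(m+n+1) sinh^(n+1) / cosh^(m+n+2)`, which are the profiles of the two neighbouring coefficients. The
binomial identities convert the factors `n` and `m+n+1` into the square roots of the ladder
operators. -/
theorem hasDerivAt_squeezedCoeff (m : ℕ) (s : ℝ) (p : ℕ × ℕ) :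
    HasDerivAt (fun s => squeezedCoeff m s p)
      (√p.1 * √p.2 * squeezedCoeff m s (p.1 - 1, p.2 - 1) -
        √(p.1 + 1) * √(p.2 + 1) * squeezedCoeff m s (p.1 + 1, p.2 + 1)) s := by
  obtain ⟨a, n⟩ := p
  by_cases ha : a = m + n
  · subst ha
    have hc := (Real.cosh_pos s).ne'
    simp only [squeezedCoeff, if_true, ← add_assoc]
    have h := (((Real.hasDerivAt_sinh s).fun_pow n).fun_div ((Real.hasDerivAt_cosh s).fun_pow (m + n + 1))
      (pow_ne_zero _ hc)).const_mul √((m + n).choose n : ℝ)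
    refine h.congr_deriv ?_
    have e1 := sqrt_succ_mul_sqrt_choose m n
    have e2 : √((m + n : ℕ) + 1 : ℝ) * √((m + n : ℕ) + 1) = (m + n : ℕ) + 1 :=
      Real.mul_self_sqrt (by positivity)
    have e3 : √((m + n : ℕ) + 1 : ℝ) * √(n + 1) *
        (√((m + n + 1).choose (n + 1) : ℝ) *
          (Real.sinh s ^ (n + 1) / Real.cosh s ^ (m + n + 1 + 1))) =
        ((m + n : ℕ) + 1) * (√((m + n).choose n : ℝ) *
          (Real.sinh s ^ (n + 1) / Real.cosh s ^ (m + n + 1 + 1))) := by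
      linear_combination (-√((m + n : ℕ) + 1 : ℝ) *
        (Real.sinh s ^ (n + 1) / Real.cosh s ^ (m + n + 1 + 1))) * e1 +
        (√((m + n).choose n : ℝ) * (Real.sinh s ^ (n + 1) / Real.cosh s ^ (m + n + 1 + 1))) * e2
    rw [e3]
    rcases n with _ | n
    · simp only [add_zero, Nat.choose_zero_right, pow_zero, Nat.cast_zero, Real.sqrt_zero]
      push_cast
      field_simp
      simp only [zero_mul, zero_sub]
      ring
    · have e4 := sqrt_succ_mul_sqrt_choose m n
      have e5 : √((n : ℝ) + 1) * √((n : ℝ) + 1) = n + 1 := Real.mul_self_sqrt (by positivity)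
      have e6 : √((m + (n + 1) : ℕ) : ℝ) * √((n + 1 : ℕ) : ℝ) *
          (if m + (n + 1) - 1 = m + (n + 1 - 1) then √((m + (n + 1 - 1)).choose (n + 1 - 1) : ℝ) *
            (Real.sinh s ^ (n + 1 - 1) / Real.cosh s ^ (m + (n + 1 - 1) + 1)) else 0) =
          (n + 1) * (√((m + n + 1).choose (n + 1) : ℝ) *
            (Real.sinh s ^ n / Real.cosh s ^ (m + n + 1))) := by
        rw [if_pos (by omega)]
        simp only [Nat.add_sub_cancel]
        push_cast at e4 ⊢
        rw [← add_assoc]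
        linear_combination (√((n : ℝ) + 1) *
          (Real.sinh s ^ n / Real.cosh s ^ (m + n + 1))) * e4 +
          (√((m + n + 1).choose (n + 1) : ℝ) * (Real.sinh s ^ n / Real.cosh s ^ (m + n + 1))) * e5
      rw [e6]
      simp only [Nat.add_sub_cancel, ← add_assoc]
      push_cast
      field_simp
      ring
  · have h0 : ∀ s, squeezedCoeff m s (a, n) = 0 := fun s => if_neg ha
    have h1 : squeezedCoeff m s (a + 1, n + 1) = 0 := if_neg (by simp only; omega)
    -- The lowered index stays off the support unless the subtraction truncates, and then a square
    -- root vanishes.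
    have h2 : √(a : ℝ) * √(n : ℝ) * squeezedCoeff m s (a - 1, n - 1) = 0 := by
      rcases a with _ | a
      · simp
      rcases n with _ | n
      · simp
      rw [squeezedCoeff, if_neg (by simp only; omega), mul_zero]
    simp only [h0]
    rw [h1, h2]
    simpa using hasDerivAt_const s (0 : ℝ)

theorem unitaryExp_squeezeGen_ket (θ : ℝ) (m : ℕ) :
    unitaryExp (squeezeGen θ) (ket (m, 0)) = squeezed m θ := by
  have h0 : squeezed m (θ * 0) = ket (m, 0) := by
    ext ⟨a, n⟩
    rw [squeezed_apply, squeezedCoeff, ket_apply]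
    rcases n with _ | n
    · by_cases h : a = m <;> simp [h]
    · simp [Prod.ext_iff]
  have h := unitaryExp_apply_of_weak_solution (isSkewLadder_squeezeGen θ)
    (ψ := fun t => squeezed m (θ * t)) (M := 1) (fun t => (norm_squeezed m _).le) fun p t => by
      have h1 := (hasDerivAt_squeezedCoeff m (θ * t) p).comp t ((hasDerivAt_id t).const_mul θ)
      refine h1.ofReal_comp.congr_deriv ?_
      rw [inner_toFock2_squeezeGen, squeezed_apply, squeezed_apply]
      push_cast
      ring
  simp only [h0, mul_one] at h
  exact h

/-- The coordinates of the beamsplitter output of `|m, 0⟩`, for the angle `s`. -/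
def rotatedCoeff (m : ℕ) (s : ℝ) (p : ℕ × ℕ) : ℝ :=
  if p.1 + p.2 = m then
    √((p.1 + p.2).choose p.2 : ℝ) * (Real.cos s ^ p.1 * (-Real.sin s) ^ p.2) else 0

/-- The beamsplitter output of `|m, 0⟩`, for the angle `s`. -/
def rotated (m : ℕ) (s : ℝ) : Fock2 :=
  ∑ p ∈ Finset.HasAntidiagonal.antidiagonal m, (rotatedCoeff m s p : ℂ) • ket p

theorem rotated_apply (m : ℕ) (s : ℝ) (p : ℕ × ℕ) :
    rotated m s p = (rotatedCoeff m s p : ℂ) := by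
  rw [← inner_ket_left, rotated, inner_sum]
  simp only [inner_smul_right, inner_ket_left, ket_apply, mul_ite, mul_one, mul_zero,
    Finset.sum_ite_eq, Finset.HasAntidiagonal.mem_antidiagonal]
  split_ifs with h
  · rfl
  · simp [rotatedCoeff, h]

/-- Only uniformity in `s` matters for a bounded weak solution, so the crude triangle inequality is
enough. -/
theorem norm_rotated_le (m : ℕ) (s : ℝ) :
    ‖rotated m s‖ ≤ ∑ p ∈ Finset.HasAntidiagonal.antidiagonal m, √((p.1 + p.2).choose p.2 : ℝ) := by
  refine (norm_sum_le _ _).trans (Finset.sum_le_sum fun p hp => ?_)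
  rw [norm_smul, norm_ket, mul_one, Complex.norm_real, rotatedCoeff,
    if_pos (Finset.HasAntidiagonal.mem_antidiagonal.1 hp), norm_mul, norm_mul, norm_pow, norm_pow, norm_neg,
    Real.norm_of_nonneg (Real.sqrt_nonneg _)]
  refine mul_le_of_le_one_right (Real.sqrt_nonneg _) (mul_le_one₀ ?_ (by positivity) ?_)
  · exact pow_le_one₀ (norm_nonneg _) (Real.abs_cos_le_one s)
  · exact pow_le_one₀ (norm_nonneg _) (Real.abs_sin_le_one s)

/-- The product rule for `cosᵃ (-sin)ⁿ` yields the two neighbours on the line `p.1 + p.2 = m`, with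
factors `a` and `n` again absorbed by binomial identities. -/
theorem hasDerivAt_rotatedCoeff (m : ℕ) (s : ℝ) (p : ℕ × ℕ) :
    HasDerivAt (fun s => rotatedCoeff m s p)
      (√p.1 * √(p.2 + 1) * rotatedCoeff m s (p.1 - 1, p.2 + 1) -
        √(p.1 + 1) * √p.2 * rotatedCoeff m s (p.1 + 1, p.2 - 1)) s := by
  obtain ⟨a, n⟩ := p
  by_cases ha : a + n = m
  · subst ha
    simp only [rotatedCoeff, if_true]
    have h := (((Real.hasDerivAt_cos s).fun_pow a).fun_mul ((Real.hasDerivAt_sin s).fun_neg.fun_pow n)).const_mul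
      √((a + n).choose n : ℝ)
    refine h.congr_deriv ?_
    have e1 : √(a : ℝ) * √(n + 1) *
        (if a - 1 + (n + 1) = a + n then √((a - 1 + (n + 1)).choose (n + 1) : ℝ) *
          (Real.cos s ^ (a - 1) * (-Real.sin s) ^ (n + 1)) else 0) =
        a * (√((a + n).choose n : ℝ) * (Real.cos s ^ (a - 1) * (-Real.sin s) ^ (n + 1))) := by
      rcases a with _ | a
      · simp
      · have e := sqrt_mul_sqrt_choose_succ a n
        have e5 : √((a : ℝ) + 1) * √((a : ℝ) + 1) = a + 1 := Real.mul_self_sqrt (by positivity)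
        rw [if_pos (by omega), show a + 1 - 1 + (n + 1) = a + 1 + n by omega, Nat.add_sub_cancel]
        push_cast
        linear_combination (-√((a : ℝ) + 1) *
          (Real.cos s ^ a * (-Real.sin s) ^ (n + 1))) * e +
          (√((a + 1 + n).choose n : ℝ) * (Real.cos s ^ a * (-Real.sin s) ^ (n + 1))) * e5
    have e2 : √((a : ℝ) + 1) * √(n : ℝ) *
        (if a + 1 + (n - 1) = a + n then √((a + 1 + (n - 1)).choose (n - 1) : ℝ) *
          (Real.cos s ^ (a + 1) * (-Real.sin s) ^ (n - 1)) else 0) =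
        n * (√((a + n).choose n : ℝ) * (Real.cos s ^ (a + 1) * (-Real.sin s) ^ (n - 1))) := by
      rcases n with _ | n
      · simp
      · have e := sqrt_mul_sqrt_choose_succ a n
        have e5 : √((n : ℝ) + 1) * √((n : ℝ) + 1) = n + 1 := Real.mul_self_sqrt (by positivity)
        rw [if_pos (by omega), Nat.add_sub_cancel, show a + (n + 1) = a + 1 + n by omega]
        push_cast
        linear_combination (√((n : ℝ) + 1) *
          (Real.cos s ^ (a + 1) * (-Real.sin s) ^ n)) * e +
          (√((a + 1 + n).choose (n + 1) : ℝ) * (Real.cos s ^ (a + 1) * (-Real.sin s) ^ n)) * e5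
    rw [e1, e2]
    ring
  · have h0 : ∀ s, rotatedCoeff m s (a, n) = 0 := fun s => if_neg ha
    have h1 : √(a : ℝ) * √((n : ℝ) + 1) * rotatedCoeff m s (a - 1, n + 1) = 0 := by
      rcases a with _ | a
      · simp
      rw [rotatedCoeff, if_neg (by simp only; omega), mul_zero]
    have h2 : √((a : ℝ) + 1) * √(n : ℝ) * rotatedCoeff m s (a + 1, n - 1) = 0 := by
      rcases n with _ | n
      · simp
      rw [rotatedCoeff, if_neg (by simp only; omega), mul_zero]
    simp only [h0]
    rw [h1, h2]
    simpa using hasDerivAt_const s (0 : ℝ)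

theorem unitaryExp_rotateGen_ket (θ : ℝ) (m : ℕ) :
    unitaryExp (rotateGen θ) (ket (m, 0)) = rotated m θ := by
  have h0 : rotated m (θ * 0) = ket (m, 0) := by
    ext ⟨a, n⟩
    rw [rotated_apply, rotatedCoeff, ket_apply]
    rcases n with _ | n
    · by_cases h : a = m <;> simp [h]
    · simp [Prod.ext_iff]
  have h := unitaryExp_apply_of_weak_solution (isSkewLadder_rotateGen θ)
    (ψ := fun t => rotated m (θ * t)) (fun t => norm_rotated_le m _) fun p t => by
      have h1 := (hasDerivAt_rotatedCoeff m (θ * t) p).comp t ((hasDerivAt_id t).const_mul θ)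
      simp only [rotated_apply]
      refine h1.ofReal_comp.congr_deriv ?_
      rw [inner_toFock2_rotateGen, rotated_apply, rotated_apply]
      push_cast
      ring
  simp only [h0, mul_one] at h
  exact h

theorem squeezing_two_ket_apply (m : ℕ) (p : ℕ × ℕ) : squeezing 2 (ket (m, 0)) p =
    if p.1 = m + p.2 then ((√(p.1.choose p.2 : ℝ) / √2 ^ (p.1 + 1) : ℝ) : ℂ) else 0 := by
  have h1 : (1 : ℝ) ≤ √2 := Real.one_le_sqrt.2 one_le_two
  have h : squeezing 2 (ket (m, 0)) = squeezed m (Real.arcosh √2) := unitaryExp_squeezeGen_ket _ m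
  rw [h, squeezed_apply, squeezedCoeff, Real.cosh_arcosh h1, Real.sinh_arcosh h1,
    Real.sq_sqrt zero_le_two]
  split_ifs with hp
  · rw [hp]
    norm_num
    ring
  · simp

theorem beamsplitter_half_ket_apply (m : ℕ) (p : ℕ × ℕ) : beamsplitter (1 / 2) (ket (m, 0)) p =
    if p.1 + p.2 = m then (((-1) ^ p.2 * √(m.choose p.2 : ℝ) / √2 ^ m : ℝ) : ℂ) else 0 := by
  have h : beamsplitter (1 / 2) (ket (m, 0)) = rotated m (Real.arccos √(1 / 2)) :=
    unitaryExp_rotateGen_ket _ m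
  have h1 : √(1 / 2 : ℝ) ≤ 1 := by
    exact Real.sqrt_le_iff.2 ⟨zero_le_one, by norm_num⟩
  have h2 : √(1 / 2 : ℝ) = (√2)⁻¹ := by rw [one_div, Real.sqrt_inv]
  rw [h, rotated_apply, rotatedCoeff,
    Real.cos_arccos (by linarith [Real.sqrt_nonneg (1 / 2)]) h1, Real.sin_arccos,
    Real.sq_sqrt (by norm_num), show (1 - 1 / 2 : ℝ) = 1 / 2 by norm_num, h2]
  split_ifs with hp
  · rw [← hp, neg_pow (√2)⁻¹, pow_add, inv_pow, inv_pow]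
    congr 1
    field_simp
  · simp

/-! ### Bounded sesquilinear forms and Hilbert–Schmidt operators -/

theorem exists_clm_of_sesquilinear {H : Type*} [NormedAddCommGroup H] [InnerProductSpace ℂ H]
    [CompleteSpace H] (B : H → H → ℂ) (C : ℝ)
    (add_left : ∀ u u' v, B (u + u') v = B u v + B u' v)
    (smul_left : ∀ (c : ℂ) u v, B (c • u) v = conj c * B u v)
    (add_right : ∀ u v v', B u (v + v') = B u v + B u v')
    (smul_right : ∀ (c : ℂ) u v, B u (c • v) = c * B u v)
    (bound : ∀ u v, ‖B u v‖ ≤ C * ‖u‖ * ‖v‖) :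
    ∃ Y : H →L[ℂ] H, ∀ u v, ⟪u, Y v⟫_ℂ = B u v := by
  let L : H →ₗ⋆[ℂ] H →ₗ[ℂ] ℂ :=
    LinearMap.mk₂'ₛₗ (starRingEnd ℂ) (RingHom.id ℂ) B add_left smul_left add_right smul_right
  -- The Riesz operator of the form sits in the left slot of the inner product; the adjoint moves it
  -- to the right.
  refine ⟨(InnerProductSpace.continuousLinearMapOfBilin
    (L.mkContinuous₂ C bound)).adjoint, fun u v => ?_⟩
  rw [ContinuousLinearMap.adjoint_inner_right, InnerProductSpace.continuousLinearMapOfBilin_apply]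
  rfl

section HilbertSchmidt
variable {H : Type*} [NormedAddCommGroup H] [InnerProductSpace ℂ H]

theorem hasSum_norm_inner_sq (b : HilbertBasis ℕ ℂ H) (x : H) :
    HasSum (fun n => ‖⟪b n, x⟫_ℂ‖ ^ 2) (‖x‖ ^ 2) := by
  have h := b.hasSum_inner_mul_inner x x
  have h2 := Complex.reCLM.hasSum h
  simp only [Complex.reCLM_apply] at h2
  rw [← inner_self_eq_norm_sq (𝕜 := ℂ) x]
  refine h2.congr_fun fun n => ?_
  rw [← inner_conj_symm x (b n), mul_comm, Complex.mul_conj, Complex.ofReal_re,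
    Complex.normSq_eq_norm_sq]

theorem summable_norm_inner_sq {A : H →L[ℂ] H} {b : HilbertBasis ℕ ℂ H}
    (hA : Summable fun n => ‖A (b n)‖ ^ 2) (c : HilbertBasis ℕ ℂ H) :
    Summable fun p : ℕ × ℕ => ‖⟪c p.2, A (b p.1)⟫_ℂ‖ ^ 2 :=
  (summable_prod_of_nonneg fun _ => by positivity).2
    ⟨fun n => (hasSum_norm_inner_sq c (A (b n))).summable,
      hA.congr fun n => (hasSum_norm_inner_sq c (A (b n))).tsum_eq.symm⟩

variable [CompleteSpace H]

/-- Both sums are iterated sums of the same nonnegative array `‖⟪c k, A (b n)⟫‖²`. Applied twice,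
this gives independence of the basis. -/
theorem summable_adjoint {A : H →L[ℂ] H} {b : HilbertBasis ℕ ℂ H}
    (hA : Summable fun n => ‖A (b n)‖ ^ 2) (c : HilbertBasis ℕ ℂ H) :
    Summable fun k => ‖A.adjoint (c k)‖ ^ 2 := by
  have h := ((summable_prod_of_nonneg fun _ => by positivity).1
    (summable_norm_inner_sq hA c).prod_symm).2
  refine h.congr fun k => ?_
  rw [← (hasSum_norm_inner_sq b (A.adjoint (c k))).tsum_eq]
  refine tsum_congr fun n => ?_
  simp only [Prod.fst_swap, Prod.snd_swap]
  rw [ContinuousLinearMap.adjoint_inner_right, ← inner_conj_symm, RCLike.norm_conj]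

theorem summable_of_summable {A : H →L[ℂ] H} {b : HilbertBasis ℕ ℂ H}
    (hA : Summable fun n => ‖A (b n)‖ ^ 2) (c : HilbertBasis ℕ ℂ H) :
    Summable fun k => ‖A (c k)‖ ^ 2 := by
  simpa using summable_adjoint (summable_adjoint hA b) c

/-- The sum `∑ ⟪A bₙ, B bₙ⟫` of two Hilbert–Schmidt operators does not depend on the basis. -/
theorem hasSum_inner_apply {A B : H →L[ℂ] H} {c : HilbertBasis ℕ ℂ H}
    (hA : Summable fun n => ‖A (c n)‖ ^ 2) (hB : Summable fun n => ‖B (c n)‖ ^ 2)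
    (b : HilbertBasis ℕ ℂ H) :
    HasSum (fun n => ⟪A (b n), B (b n)⟫_ℂ) (∑' k, ⟪B.adjoint (c k), A.adjoint (c k)⟫_ℂ) := by
  have h1 := summable_norm_inner_sq (summable_of_summable hA b) c
  have h2 := summable_norm_inner_sq (summable_of_summable hB b) c
  have hF : Summable fun p : ℕ × ℕ => ⟪A (b p.1), c p.2⟫_ℂ * ⟪c p.2, B (b p.1)⟫_ℂ := by
    refine Summable.of_norm_bounded (h1.add h2) fun p => ?_
    rw [norm_mul, ← inner_conj_symm, RCLike.norm_conj]
    nlinarith [sq_nonneg (‖⟪c p.2, A (b p.1)⟫_ℂ‖ - ‖⟪c p.2, B (b p.1)⟫_ℂ‖),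
      sq_nonneg ‖⟪c p.2, A (b p.1)⟫_ℂ‖, sq_nonneg ‖⟪c p.2, B (b p.1)⟫_ℂ‖]
  -- Parseval in `c` along the rows of the array gives the left sum, Parseval in `b` along its
  -- columns gives the right one, where `b` no longer appears.
  have h3 := hF.hasSum.prod_fiberwise fun n =>
    c.hasSum_inner_mul_inner (A (b n)) (B (b n))
  have h4 := hF.prod_symm.hasSum.prod_fiberwise fun k => by
    have h := b.hasSum_inner_mul_inner (B.adjoint (c k)) (A.adjoint (c k))
    refine h.congr_fun fun n => ?_
    simp only [Prod.fst_swap, Prod.snd_swap]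
    rw [ContinuousLinearMap.adjoint_inner_left, ContinuousLinearMap.adjoint_inner_right, mul_comm]
  have h5 := (Equiv.prodComm ℕ ℕ).tsum_eq
    fun p : ℕ × ℕ => ⟪A (b p.1), c p.2⟫_ℂ * ⟪c p.2, B (b p.1)⟫_ℂ
  rw [h4.tsum_eq]
  rw [← h5] at h3
  exact h3

end HilbertSchmidt

/-! ### Existence of partial traces -/

/-- The bounded operator `v ↦ u ⊗ v`. -/
def tensorLeft (u : Fock) : Fock →L[ℂ] Fock2 :=
  LinearMap.mkContinuous
    { toFun := fun v => tensor u v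
      map_add' := fun v v' => by ext p; simp [mul_add]
      map_smul' := fun c v => by ext p; simp [mul_left_comm] }
    ‖u‖ (fun v => (norm_tensor u v).le)

theorem tensor_add_left (u u' v : Fock) : tensor (u + u') v = tensor u v + tensor u' v :=
  map_add (tensorRight v) u u'

theorem tensor_smul_left (c : ℂ) (u v : Fock) : tensor (c • u) v = c • tensor u v :=
  map_smul (tensorRight v) c u

theorem norm_tsum_inner_le {f g : ℕ → Fock} {a b : ℝ} (ha : 0 ≤ a) (hb : 0 ≤ b)
    (hf : HasSum (fun n => ‖f n‖ ^ 2) (a ^ 2)) (hg : HasSum (fun n => ‖g n‖ ^ 2) (b ^ 2)) :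
    Summable (fun n => ‖f n‖ * ‖g n‖) ∧ ∑' n, ‖f n‖ * ‖g n‖ ≤ a * b := by
  have h := Real.inner_le_Lp_mul_Lq_tsum_of_nonneg (p := 2) (q := 2) (f := fun n => ‖f n‖)
    (g := fun n => ‖g n‖) Real.HolderConjugate.two_two (fun _ => norm_nonneg _)
    (fun _ => norm_nonneg _) (by simpa using hf.summable) (by simpa using hg.summable)
  refine ⟨Summable.of_nonneg_of_le (fun _ => by positivity) (fun n => ?_)
    (hf.summable.add hg.summable), h.trans (le_of_eq ?_)⟩
  · nlinarith [sq_nonneg (‖f n‖ - ‖g n‖), sq_nonneg ‖f n‖, sq_nonneg ‖g n‖]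
  simp only [Real.rpow_ofNat]
  rw [hf.tsum_eq, hg.tsum_eq, ← Real.sqrt_eq_rpow, ← Real.sqrt_eq_rpow, Real.sqrt_sq ha,
    Real.sqrt_sq hb]

/-- The hypothesis says that `A u : v ↦ J† (u ⊗ v)` is Hilbert–Schmidt with norm `κ ‖u‖`. The terms
of the partial trace are `⟪A u bₙ, X (A v bₙ)⟫`, so their sum converges independently of the basis,
and Cauchy–Schwarz bounds the resulting form by `κ² ‖X‖ ‖u‖ ‖v‖`. -/
theorem exists_isPartialTrace {J : Fock →L[ℂ] Fock2} {κ : ℝ} (hκ : 0 ≤ κ)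
    (hJ : ∀ u, HasSum (fun n => ‖J.adjoint (tensor u (ket n))‖ ^ 2) ((κ * ‖u‖) ^ 2))
    (X : Fock →L[ℂ] Fock) : ∃ Y, IsPartialTrace (J ∘L X ∘L J.adjoint) Y := by
  let A : Fock → Fock →L[ℂ] Fock := fun u => J.adjoint ∘L tensorLeft u
  have hA : ∀ u, Summable fun n => ‖A u (ketBasis ℕ n)‖ ^ 2 := fun u => by
    simp only [ketBasis_apply]
    exact (hJ u).summable
  have hXA : ∀ u, Summable fun n => ‖(X ∘L A u) (ketBasis ℕ n)‖ ^ 2 := fun u => by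
    refine Summable.of_nonneg_of_le (fun _ => by positivity) (fun n => ?_)
      ((hA u).mul_left (‖X‖ ^ 2))
    rw [← mul_pow]
    exact pow_le_pow_left₀ (norm_nonneg _) (X.le_opNorm _) 2
  have hs := fun u v b => hasSum_inner_apply (hA u) (hXA v) b
  have hsum : ∀ u v, Summable fun n =>
      ⟪J.adjoint (tensor u (ket n)), X (J.adjoint (tensor v (ket n)))⟫_ℂ := fun u v => by
    have h := (hs u v (ketBasis ℕ)).summable
    simp only [ketBasis_apply] at h
    exact h
  obtain ⟨Y, hY⟩ := exists_clm_of_sesquilinear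
    (fun u v => ∑' n, ⟪J.adjoint (tensor u (ket n)), X (J.adjoint (tensor v (ket n)))⟫_ℂ)
    (κ * κ * ‖X‖)
    (fun u u' v => by
      rw [← (hsum u v).tsum_add (hsum u' v)]
      simp only [tensor_add_left, map_add, inner_add_left])
    (fun c u v => by
      rw [← tsum_mul_left]
      simp only [tensor_smul_left, map_smul, inner_smul_left])
    (fun u v v' => by
      rw [← (hsum u v).tsum_add (hsum u v')]
      simp only [tensor_add_left, map_add, inner_add_right])
    (fun c u v => by
      rw [← tsum_mul_left]
      simp only [tensor_smul_left, map_smul, inner_smul_right])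
    (fun u v => by
      obtain ⟨h1, h2⟩ := norm_tsum_inner_le (by positivity) (by positivity) (hJ u) (hJ v)
      refine (tsum_of_norm_bounded (h1.hasSum.mul_left ‖X‖) fun n => ?_).trans ?_
      · refine (norm_inner_le_norm _ _).trans ?_
        rw [mul_left_comm]
        exact mul_le_mul_of_nonneg_left (X.le_opNorm _) (norm_nonneg _)
      · refine (mul_le_mul_of_nonneg_left h2 (norm_nonneg X)).trans (le_of_eq ?_)
        ring)
  refine ⟨Y, fun b u v => ?_⟩
  have h1 := hs u v b
  rw [hY]
  have h2 : ∑' n, ⟪J.adjoint (tensor u (ket n)), X (J.adjoint (tensor v (ket n)))⟫_ℂ =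
      ∑' k, ⟪(X ∘L A v).adjoint (ketBasis ℕ k), (A u).adjoint (ketBasis ℕ k)⟫_ℂ := by
    rw [← (hs u v (ketBasis ℕ)).tsum_eq]
    simp only [ketBasis_apply]
    rfl
  rw [h2]
  refine h1.congr_fun fun n => ?_
  exact (ContinuousLinearMap.adjoint_inner_left J _ _).symm

/-- Existence excludes the default value 0 of `partialTrace`. -/
theorem partialTrace_spec {T : Fock2 →L[ℂ] Fock2} (h : ∃ Y, IsPartialTrace T Y) :
    IsPartialTrace T (partialTrace T) := by
  rw [partialTrace, dif_pos h]
  exact h.choose_spec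

/-- The operator `u ↦ W (u ⊗ |0⟩)`. -/
def vacuumIsometry (W : Fock2 →L[ℂ] Fock2) : Fock →L[ℂ] Fock2 := W ∘L tensorRight vacuum

theorem dilation_eq (W : Fock2 →L[ℂ] Fock2) (X : Fock →L[ℂ] Fock) :
    dilation W X = vacuumIsometry W ∘L X ∘L (vacuumIsometry W).adjoint := by
  rw [dilation, tensorVacuum, vacuumIsometry, ContinuousLinearMap.adjoint_comp]
  rfl

theorem hasSum_of_isPartialTrace {W : Fock2 →L[ℂ] Fock2} {X Y : Fock →L[ℂ] Fock}
    (h : IsPartialTrace (dilation W X) Y) (u v : Fock) :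
    HasSum (fun n => ⟪(vacuumIsometry W).adjoint (tensor u (ket n)),
      X ((vacuumIsometry W).adjoint (tensor v (ket n)))⟫_ℂ) ⟪u, Y v⟫_ℂ := by
  refine (h (ketBasis ℕ) u v).congr_fun fun n => ?_
  rw [dilation_eq, ketBasis_apply]
  exact ContinuousLinearMap.adjoint_inner_left (vacuumIsometry W) _ _

theorem vacuumIsometry_ket (W : Fock2 →L[ℂ] Fock2) (k : ℕ) :
    vacuumIsometry W (ket k) = W (ket (k, 0)) := by
  rw [vacuumIsometry, ContinuousLinearMap.comp_apply, tensorRight_apply]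
  congr 1
  ext ⟨a, b⟩
  change ket k a * ket 0 b = _
  simp only [ket_apply, Prod.mk.injEq, mul_ite, mul_one, mul_zero]
  split_ifs <;> simp_all

/-- `u ↦ J† (u ⊗ |n⟩)` is the adjoint of the `n`-th Kraus operator. Its coordinates involve `W` only
on states with empty ancilla. -/
theorem hasSum_adjoint_vacuumIsometry (W : Fock2 →L[ℂ] Fock2) (u : Fock) (n k : ℕ) :
    HasSum (fun j => conj (W (ket (k, 0)) (j, n)) * u j)
      ((vacuumIsometry W).adjoint (tensor u (ket n)) k) := by
  rw [← inner_ket_left, ContinuousLinearMap.adjoint_inner_right, vacuumIsometry_ket]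
  have h : HasSum (fun p => ⟪W (ket (k, 0)) p, tensor u (ket n) p⟫_ℂ)
      ⟪W (ket (k, 0)), tensor u (ket n)⟫_ℂ := lp.hasSum_inner _ _
  have hi : Function.Injective fun j : ℕ => (j, n) := fun a b h => (Prod.ext_iff.1 h).1
  refine ((hi.hasSum_iff ?_).2 h).congr_fun fun j => ?_
  · rintro ⟨a, b⟩ hp
    have : b ≠ n := fun h => hp ⟨a, by rw [h]⟩
    simp [ket_apply, this]
  · simp [ket_apply, mul_comm]

/-! ### Kraus operators of the two channels -/

theorem amplifier_adjoint_apply (u : Fock) (n k : ℕ) :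
    (vacuumIsometry (squeezing 2)).adjoint (tensor u (ket n)) k =
      ((√((k + n).choose n : ℝ) / √2 ^ (k + n + 1) : ℝ) : ℂ) * u (k + n) := by
  refine (hasSum_adjoint_vacuumIsometry (squeezing 2) u n k).unique ?_
  convert hasSum_single (k + n) ?_ using 1
  · rw [squeezing_two_ket_apply, if_pos rfl, Complex.conj_ofReal]
  · intro j hj
    rw [squeezing_two_ket_apply, if_neg hj, map_zero, zero_mul]

theorem attenuator_adjoint_apply_of_le (u : Fock) (n j : ℕ) :
    (vacuumIsometry (beamsplitter (1 / 2))).adjoint (tensor u (ket n)) (n + j) =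
      (((-1) ^ n * √((n + j).choose n : ℝ) / √2 ^ (n + j) : ℝ) : ℂ) * u j := by
  refine (hasSum_adjoint_vacuumIsometry (beamsplitter (1 / 2)) u n (n + j)).unique ?_
  convert hasSum_single j ?_ using 1
  · rw [beamsplitter_half_ket_apply, if_pos (add_comm _ _), Complex.conj_ofReal]
  · intro i hi
    rw [beamsplitter_half_ket_apply, if_neg (by simp only; omega), map_zero, zero_mul]

theorem attenuator_adjoint_apply_of_lt (u : Fock) {n k : ℕ} (h : k < n) :
    (vacuumIsometry (beamsplitter (1 / 2))).adjoint (tensor u (ket n)) k = 0 := by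
  refine (hasSum_adjoint_vacuumIsometry (beamsplitter (1 / 2)) u n k).unique ?_
  convert hasSum_zero using 2 with i
  rw [beamsplitter_half_ket_apply, if_neg (by simp only; omega), map_zero, zero_mul]

theorem hasSum_fock_norm_sq {ι : Type*} (u : ℓ²(ι, ℂ)) :
    HasSum (fun k => ‖u k‖ ^ 2) (‖u‖ ^ 2) := by
  simpa using lp.hasSum_norm (p := 2) (by norm_num) u

theorem hasSum_prod_of_nonneg {f : ℕ × ℕ → ℝ} (hf : 0 ≤ f) {g : ℕ → ℝ} {a : ℝ}
    (h1 : ∀ n, HasSum (fun k => f (n, k)) (g n)) (h2 : HasSum g a) : HasSum f a := by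
  have h : Summable f := (summable_prod_of_nonneg hf).2
    ⟨fun n => (h1 n).summable, h2.summable.congr fun n => (h1 n).tsum_eq.symm⟩
  have h3 := h.hasSum.prod_fiberwise h1
  rw [h2.unique h3]
  exact h.hasSum

/-- Indexed by the total `N = k + n`, the weights `choose N n / 2 ^ (N + 1)` sum over `n` to `1/2`.
The constant reflects that the amplifier maps the identity to half of it. -/
theorem hasSum_amplifier (u : Fock) :
    HasSum (fun n => ‖(vacuumIsometry (squeezing 2)).adjoint (tensor u (ket n))‖ ^ 2)
      ((√(1 / 2) * ‖u‖) ^ 2) := by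
  have h1 : HasSum (fun p : ℕ × ℕ => (p.1.choose p.2 : ℝ) / 2 ^ (p.1 + 1) * ‖u p.1‖ ^ 2)
      ((√(1 / 2) * ‖u‖) ^ 2) := by
    refine hasSum_prod_of_nonneg (fun p => by positivity) (g := fun N => 1 / 2 * ‖u N‖ ^ 2)
      (fun N => ?_) ?_
    · have h : HasSum (fun k => (N.choose k : ℝ) / 2 ^ (N + 1) * ‖u N‖ ^ 2)
          (∑ k ∈ Finset.range (N + 1), (N.choose k : ℝ) / 2 ^ (N + 1) * ‖u N‖ ^ 2) :=
        hasSum_sum_of_ne_finset_zero fun k hk => by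
          rw [Nat.choose_eq_zero_of_lt (by simpa using hk)]
          simp
      convert h using 1
      rw [← Finset.sum_mul, ← Finset.sum_div]
      have h2 : (∑ k ∈ Finset.range (N + 1), (N.choose k : ℝ)) = 2 ^ N := by
        exact_mod_cast Nat.sum_range_choose N
      rw [h2]
      field_simp
      ring
    · rw [mul_pow, Real.sq_sqrt (by norm_num)]
      exact (hasSum_fock_norm_sq u).mul_left _
  have hi : Function.Injective fun p : ℕ × ℕ => (p.2 + p.1, p.1) := by
    rintro ⟨a, b⟩ ⟨c, d⟩ h
    simp only [Prod.mk.injEq] at h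
    ext <;> simp only <;> omega
  have h2 := (hi.hasSum_iff (fun p hp => by
    have : p.1 < p.2 := by
      by_contra h
      exact hp ⟨(p.2, p.1 - p.2), Prod.ext (by simp only; omega) rfl⟩
    rw [Nat.choose_eq_zero_of_lt this]
    simp)).2 h1
  refine h2.prod_fiberwise fun n => ?_
  refine (hasSum_fock_norm_sq _).congr_fun fun k => ?_
  rw [amplifier_adjoint_apply, norm_mul, Complex.norm_real, mul_pow, Real.norm_eq_abs, sq_abs,
    div_pow, Real.sq_sqrt (by positivity), ← pow_mul, mul_comm _ 2, pow_mul,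
    Real.sq_sqrt zero_le_two]
  rfl

/-- For fixed `j = p.2`, the negative binomial series at `1/2` gives `2 ^ (j + 1)`, hence the factor
2: the attenuator doubles the identity. -/
theorem hasSum_choose_mul_norm_sq (u : Fock) :
    HasSum (fun p : ℕ × ℕ =>
      ((p.1 + p.2).choose p.2 : ℝ) * (1 / 2) ^ p.1 * ((1 / 2) ^ p.2 * ‖u p.2‖ ^ 2))
      (2 * ‖u‖ ^ 2) := by
  have h1 : HasSum (fun p : ℕ × ℕ =>
      ((p.2 + p.1).choose p.1 : ℝ) * (1 / 2) ^ p.2 * ((1 / 2) ^ p.1 * ‖u p.1‖ ^ 2))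
      (2 * ‖u‖ ^ 2) := by
    refine hasSum_prod_of_nonneg (fun p => by positivity) (g := fun j => 2 * ‖u j‖ ^ 2)
      (fun j => ?_) ((hasSum_fock_norm_sq u).mul_left _)
    have h := (hasSum_choose_mul_geometric_of_norm_lt_one j
      (r := (1 / 2 : ℝ)) (by norm_num)).mul_right ((1 / 2) ^ j * ‖u j‖ ^ 2)
    have e : 1 / (1 - 1 / 2 : ℝ) ^ (j + 1) * ((1 / 2) ^ j * ‖u j‖ ^ 2) = 2 * ‖u j‖ ^ 2 := by
      rw [show (1 - 1 / 2 : ℝ) = 1 / 2 by norm_num, pow_succ]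
      field_simp
    rwa [e] at h
  exact (Equiv.prodComm ℕ ℕ).hasSum_iff.2 h1

theorem norm_attenuator_adjoint_apply_sq (u : Fock) (n j : ℕ) :
    ‖(vacuumIsometry (beamsplitter (1 / 2))).adjoint (tensor u (ket n)) (n + j)‖ ^ 2 =
      ((n + j).choose j : ℝ) * (1 / 2) ^ n * ((1 / 2) ^ j * ‖u j‖ ^ 2) := by
  rw [attenuator_adjoint_apply_of_le, norm_mul, Complex.norm_real, mul_pow, Real.norm_eq_abs,
    sq_abs, div_pow, mul_pow, Real.sq_sqrt (by positivity), ← pow_mul, ← pow_mul,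
    mul_comm _ 2, pow_mul, mul_comm _ 2, pow_mul, Real.sq_sqrt zero_le_two, neg_one_sq,
    one_pow, one_mul, pow_add, one_div, inv_pow, inv_pow, Nat.choose_symm_add]
  field_simp

theorem hasSum_attenuator_prod (u : Fock) :
    HasSum (fun p : ℕ × ℕ =>
      ‖(vacuumIsometry (beamsplitter (1 / 2))).adjoint (tensor u (ket p.1)) p.2‖ ^ 2)
      (2 * ‖u‖ ^ 2) := by
  have hi : Function.Injective fun p : ℕ × ℕ => (p.1, p.1 + p.2) := by
    rintro ⟨a, b⟩ ⟨c, d⟩ h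
    simp only [Prod.mk.injEq] at h
    ext <;> simp only <;> omega
  refine (hi.hasSum_iff fun p hp => ?_).1
    ((hasSum_choose_mul_norm_sq u).congr_fun fun p => norm_attenuator_adjoint_apply_sq u p.1 p.2)
  have : p.2 < p.1 := by
    by_contra h
    exact hp ⟨(p.1, p.2 - p.1), Prod.ext rfl (by simp only; omega)⟩
  rw [attenuator_adjoint_apply_of_lt u this]
  simp

theorem hasSum_attenuator (u : Fock) :
    HasSum (fun n => ‖(vacuumIsometry (beamsplitter (1 / 2))).adjoint (tensor u (ket n))‖ ^ 2)
      ((√2 * ‖u‖) ^ 2) := by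
  rw [mul_pow, Real.sq_sqrt zero_le_two]
  exact HasSum.prod_fiberwise (hasSum_attenuator_prod u) fun n =>
    hasSum_fock_norm_sq ((vacuumIsometry (beamsplitter (1 / 2))).adjoint (tensor u (ket n)))

theorem isPartialTrace_amplifier (X : Fock →L[ℂ] Fock) :
    IsPartialTrace (dilation (squeezing 2) X) (amplifier 2 X) := by
  refine partialTrace_spec ?_
  rw [dilation_eq]
  exact exists_isPartialTrace (Real.sqrt_nonneg _) hasSum_amplifier X

theorem isPartialTrace_attenuator (X : Fock →L[ℂ] Fock) :
    IsPartialTrace (dilation (beamsplitter (1 / 2)) X) (attenuator (1 / 2) X) := by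
  refine partialTrace_spec ?_
  rw [dilation_eq]
  exact exists_isPartialTrace (Real.sqrt_nonneg _) hasSum_attenuator X

/-! ### Exponential vectors -/

/-- The unnormalized coherent state `∑ₙ αⁿ / √(n!) |n⟩`. -/
def expVec (α : ℂ) : Fock := (Real.exp (‖α‖ ^ 2 / 2) : ℂ) • coherent α

theorem expVec_apply (α : ℂ) (n : ℕ) : expVec α n = α ^ n / (√(n.factorial : ℝ) : ℂ) := by
  change (Real.exp (‖α‖ ^ 2 / 2) : ℂ) * coherent α n = _
  rw [coherent_apply, ← mul_assoc, ← Complex.ofReal_mul, ← Real.exp_add, neg_div, add_neg_cancel,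
    Real.exp_zero, Complex.ofReal_one, one_mul]

theorem coherent_eq_smul_expVec (α : ℂ) :
    coherent α = (Real.exp (-‖α‖ ^ 2 / 2) : ℂ) • expVec α := by
  rw [expVec, smul_smul, ← Complex.ofReal_mul, ← Real.exp_add, neg_div, neg_add_cancel,
    Real.exp_zero, Complex.ofReal_one, one_smul]

theorem ofReal_sqrt_mul_self {x : ℝ} (hx : 0 ≤ x) : (√x : ℂ) * (√x : ℂ) = (x : ℂ) := by
  rw [← Complex.ofReal_mul, Real.mul_self_sqrt hx]

theorem hasSum_pow_div_factorial (z : ℂ) :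
    HasSum (fun n : ℕ => z ^ n / n.factorial) (Complex.exp z) := by
  rw [Complex.exp_eq_exp_ℂ]
  exact NormedSpace.expSeries_div_hasSum_exp z

theorem inner_expVec (α β : ℂ) : ⟪expVec α, expVec β⟫_ℂ = Complex.exp (conj α * β) := by
  have h : HasSum (fun n => ⟪expVec α n, expVec β n⟫_ℂ) ⟪expVec α, expVec β⟫_ℂ :=
    lp.hasSum_inner _ _
  refine h.unique ((hasSum_pow_div_factorial (conj α * β)).congr_fun fun n => ?_)
  rw [expVec_apply, expVec_apply, RCLike.inner_apply, map_div₀, map_pow, Complex.conj_ofReal,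
    div_mul_div_comm, ofReal_sqrt_mul_self (by positivity), mul_pow, mul_comm (β ^ n)]
  simp

theorem eq_zero_of_hasSum_pow {c : ℕ → ℂ} (h : ∀ z : ℂ, HasSum (fun n => z ^ n * c n) 0) :
    c = 0 := by
  have h1 : HasFPowerSeriesAt 0 (FormalMultilinearSeries.ofScalars ℂ c) (0 : ℂ) := by
    rw [hasFPowerSeriesAt_iff]
    refine Eventually.of_forall fun z => ?_
    simpa only [FormalMultilinearSeries.coeff_ofScalars, smul_eq_mul, Pi.zero_apply] using h z
  have h2 := h1.eq_zero
  funext n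
  rw [← FormalMultilinearSeries.coeff_ofScalars (𝕜 := ℂ) (p := c), h2]
  rfl

/-- Pairing `x` with `e(z)` is an entire power series in `z` with coefficients `conj (x n) / √(n!)`;
if it vanishes identically, so does `x`. -/
theorem dense_span_expVec : Dense (Submodule.span ℂ (Set.range expVec) : Set Fock) := by
  rw [Submodule.dense_iff_topologicalClosure_eq_top, Submodule.topologicalClosure_eq_top_iff,
    Submodule.eq_bot_iff]
  intro x hx
  have h : ∀ z : ℂ, HasSum (fun n : ℕ => z ^ n * (conj (x n) / (√(n.factorial : ℝ) : ℂ))) 0 := by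
    intro z
    have h1 : HasSum (fun n => ⟪x n, expVec z n⟫_ℂ) ⟪x, expVec z⟫_ℂ := lp.hasSum_inner _ _
    rw [Submodule.inner_left_of_mem_orthogonal (Submodule.subset_span (Set.mem_range_self z)) hx] at h1
    refine h1.congr_fun fun n => ?_
    rw [expVec_apply, RCLike.inner_apply]
    ring
  have h2 := eq_zero_of_hasSum_pow h
  ext n
  have h3 := congrFun h2 n
  have h4 : (√(n.factorial : ℝ) : ℂ) ≠ 0 := by
    exact_mod_cast (Real.sqrt_pos.2 (by positivity)).ne'
  simpa [h4] using h3

theorem expVec_induction {P : Fock → Prop} (mem : ∀ β, P (expVec β)) (zero : P 0)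
    (add : ∀ x y, P x → P y → P (x + y)) (smul : ∀ (c : ℂ) x, P x → P (c • x))
    (closed : IsClosed {x | P x}) (x : Fock) : P x :=
  closed.closure_subset_iff.2 (fun y hy => Submodule.span_induction
    (p := fun y _ => P y) (by rintro _ ⟨β, rfl⟩; exact mem β) zero (fun x y _ _ => add x y)
    (fun c x _ => smul c x) hy) (dense_span_expVec x)

theorem clm_ext_expVec {Y Z : Fock →L[ℂ] Fock}
    (h : ∀ β γ, ⟪expVec β, Y (expVec γ)⟫_ℂ = ⟪expVec β, Z (expVec γ)⟫_ℂ) : Y = Z := by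
  refine ContinuousLinearMap.ext_on dense_span_expVec ?_
  rintro _ ⟨γ, rfl⟩
  refine ext_inner_left ℂ fun u => ?_
  refine expVec_induction (P := fun u => ⟪u, Y (expVec γ)⟫_ℂ = ⟪u, Z (expVec γ)⟫_ℂ)
    (fun β => h β γ) (by simp) (fun x y hx hy => ?_) (fun c x hx => ?_)
    (isClosed_eq (by fun_prop) (by fun_prop)) u
  · rw [inner_add_left, inner_add_left, hx, hy]
  · rw [inner_smul_left, inner_smul_left, hx]

/-- For unit vectors `‖α - β‖² = 2 - 2 Re ⟨α|β⟩`, and the overlap is explicit. -/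
theorem continuous_coherent : Continuous coherent := by
  have hin : ∀ α β : ℂ, ⟪coherent α, coherent β⟫_ℂ =
      ((Real.exp (-‖α‖ ^ 2 / 2) : ℝ) : ℂ) * (((Real.exp (-‖β‖ ^ 2 / 2) : ℝ) : ℂ) *
        Complex.exp (conj α * β)) := fun α β => by
    rw [coherent_eq_smul_expVec, coherent_eq_smul_expVec β, inner_smul_left, inner_smul_right,
      inner_expVec, Complex.conj_ofReal]
  refine continuous_iff_continuousAt.2 fun β => ?_
  have h1 : ∀ α, ‖coherent α - coherent β‖ ^ 2 = 2 - 2 * (⟪coherent α, coherent β⟫_ℂ).re := by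
    intro α
    rw [@norm_sub_sq ℂ, norm_coherent, norm_coherent]
    simp only [RCLike.re_to_complex]
    ring
  have h2 : Continuous fun α => 2 - 2 * (⟪coherent α, coherent β⟫_ℂ).re := by
    simp only [hin]
    fun_prop
  have h3 : Tendsto (fun α => ‖coherent α - coherent β‖ ^ 2) (𝓝 β) (𝓝 0) := by
    have h := h2.tendsto β
    simp only [← h1] at h
    simpa using h
  have h4 := h3.sqrt
  simp only [Real.sqrt_sq (norm_nonneg _), Real.sqrt_zero] at h4
  exact tendsto_iff_norm_sub_tendsto_zero.2 h4

/-! ### Gaussian integrals over the plane -/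

/-- The Gaussian `exp (-c |α|² + a α + b ᾱ)`. -/
def gauss (c : ℝ) (a b α : ℂ) : ℂ := Complex.exp (-c * ‖α‖ ^ 2 + a * α + b * conj α)

theorem gauss_ofReal_add (c : ℝ) (a b : ℂ) (p : ℝ × ℝ) :
    gauss c a b (Complex.measurableEquivRealProd.symm p) =
      Complex.exp (-(c : ℂ) * (p.1 : ℂ) ^ 2 + (a + b) * p.1 + 0) *
        Complex.exp (-(c : ℂ) * (p.2 : ℂ) ^ 2 + (Complex.I * (a - b)) * p.2 + 0) := by
  have h1 : ((‖(⟨p.1, p.2⟩ : ℂ)‖ ^ 2 : ℝ) : ℂ) = (p.1 : ℂ) ^ 2 + (p.2 : ℂ) ^ 2 := by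
    rw [← Complex.normSq_eq_norm_sq, Complex.normSq_mk]
    push_cast
    ring
  have h2 : (⟨p.1, p.2⟩ : ℂ) = p.1 + p.2 * Complex.I := Complex.mk_eq_add_mul_I _ _
  push_cast at h1
  rw [gauss, Complex.measurableEquivRealProd_symm_apply, h1, h2, ← Complex.exp_add]
  congr 1
  simp only [map_add, map_mul, Complex.conj_ofReal, Complex.conj_I]
  ring

theorem integrable_gauss {c : ℝ} (hc : 0 < c) (a b : ℂ) : Integrable (gauss c a b) := by
  have he := Complex.volume_preserving_equiv_real_prod.symm
  rw [← he.integrable_comp_emb Complex.measurableEquivRealProd.symm.measurableEmbedding]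
  have h : gauss c a b ∘ Complex.measurableEquivRealProd.symm = fun p : ℝ × ℝ =>
      Complex.exp (-(c : ℂ) * (p.1 : ℂ) ^ 2 + (a + b) * p.1 + 0) *
        Complex.exp (-(c : ℂ) * (p.2 : ℂ) ^ 2 + (Complex.I * (a - b)) * p.2 + 0) :=
    funext (gauss_ofReal_add c a b)
  rw [h]
  exact Integrable.mul_prod (integrable_cexp_quadratic (by simpa using hc) _ _)
    (integrable_cexp_quadratic (by simpa using hc) _ _)

theorem integral_gauss {c : ℝ} (hc : 0 < c) (a b : ℂ) :
    ∫ α, gauss c a b α = Real.pi / c * Complex.exp (a * b / c) := by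
  have he := Complex.volume_preserving_equiv_real_prod.symm
  have hc' : (c : ℂ) ≠ 0 := by exact_mod_cast hc.ne'
  rw [← he.integral_comp Complex.measurableEquivRealProd.symm.measurableEmbedding]
  simp only [gauss_ofReal_add]
  have h := integral_prod_mul (μ := (volume : Measure ℝ)) (ν := (volume : Measure ℝ))
    (fun x : ℝ => Complex.exp (-(c : ℂ) * (x : ℂ) ^ 2 + (a + b) * x + 0))
    (fun x : ℝ => Complex.exp (-(c : ℂ) * (x : ℂ) ^ 2 + (Complex.I * (a - b)) * x + 0))
  refine h.trans ?_
  rw [integral_cexp_quadratic (by simpa using hc), integral_cexp_quadratic (by simpa using hc),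
    mul_mul_mul_comm, ← Complex.exp_add, neg_neg,
    ← Complex.cpow_add _ _ (div_ne_zero (by exact_mod_cast Real.pi_pos.ne') hc')]
  norm_num
  left
  congr 1
  -- The two one-dimensional exponents add up to `((a + b)² - (a - b)²) / (4c) = ab / c`.
  rw [mul_pow, Complex.I_sq]
  field_simp
  ring

/-! ### The resolution of the identity by coherent states -/

theorem inner_coherent_expVec (α β : ℂ) : ⟪coherent α, expVec β⟫_ℂ =
    Complex.exp (-(‖α‖ ^ 2 : ℂ) / 2 + β * conj α) := by
  rw [coherent_eq_smul_expVec, inner_smul_left, inner_expVec, Complex.conj_ofReal,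
    Complex.ofReal_exp, ← Complex.exp_add]
  push_cast
  ring_nf

theorem inner_expVec_coherent (α β : ℂ) : ⟪expVec β, coherent α⟫_ℂ =
    Complex.exp (-(‖α‖ ^ 2 : ℂ) / 2 + conj β * α) := by
  rw [coherent_eq_smul_expVec, inner_smul_right, inner_expVec,
    Complex.ofReal_exp, ← Complex.exp_add]
  push_cast
  ring_nf

theorem resolution_expVec (β γ : ℂ) :
    (fun α => ⟪expVec β, coherent α⟫_ℂ * ⟪coherent α, expVec γ⟫_ℂ) = gauss 1 (conj β) γ := by
  funext α
  rw [inner_coherent_expVec, inner_expVec_coherent, ← Complex.exp_add, gauss]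
  congr 1
  push_cast
  ring

theorem continuous_inner_coherent_mul (u v : Fock) :
    Continuous fun α => ⟪u, coherent α⟫_ℂ * ⟪coherent α, v⟫_ℂ :=
  (continuous_const.inner continuous_coherent).mul (continuous_coherent.inner continuous_const)

theorem resolution_span {u v : Fock} (hu : u ∈ Submodule.span ℂ (Set.range expVec))
    (hv : v ∈ Submodule.span ℂ (Set.range expVec)) :
    Integrable (fun α => ⟪u, coherent α⟫_ℂ * ⟪coherent α, v⟫_ℂ) ∧
      ∫ α, ⟪u, coherent α⟫_ℂ * ⟪coherent α, v⟫_ℂ = Real.pi * ⟪u, v⟫_ℂ := by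
  induction hu using Submodule.span_induction with
  | zero => simp
  | add x y _ _ hx hy =>
    simp only [inner_add_left, add_mul]
    refine ⟨hx.1.add hy.1, ?_⟩
    rw [integral_add hx.1 hy.1, hx.2, hy.2, mul_add]
  | smul a x _ hx =>
    simp only [inner_smul_left, mul_assoc]
    refine ⟨hx.1.const_mul _, ?_⟩
    rw [integral_const_mul, hx.2, mul_left_comm]
  | mem x h =>
    obtain ⟨β, rfl⟩ := h
    induction hv using Submodule.span_induction with
    | zero => simp
    | add x y _ _ hx hy =>
      simp only [inner_add_right, mul_add]
      refine ⟨hx.1.add hy.1, ?_⟩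
      rw [integral_add hx.1 hy.1, hx.2, hy.2]
    | smul a x _ hx =>
      simp only [inner_smul_right, mul_left_comm _ a]
      refine ⟨hx.1.const_mul _, ?_⟩
      rw [integral_const_mul, hx.2]
    | mem x h =>
      obtain ⟨γ, rfl⟩ := h
      rw [resolution_expVec, inner_expVec, integral_gauss one_pos]
      exact ⟨integrable_gauss one_pos _ _, by simp⟩

theorem inner_mul_inner_self (u x : Fock) :
    ⟪u, x⟫_ℂ * ⟪x, u⟫_ℂ = ((‖⟪x, u⟫_ℂ‖ ^ 2 : ℝ) : ℂ) := by
  rw [← inner_conj_symm u x, mul_comm, Complex.mul_conj, Complex.normSq_eq_norm_sq]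

/-- Equality holds on the span of the exponential vectors. Fatou's lemma passes to the closure with
an inequality, which suffices for integrability and for a bounded form. -/
theorem lintegral_norm_inner_coherent_sq_le (u : Fock) :
    ∫⁻ α, ‖‖⟪coherent α, u⟫_ℂ‖ ^ 2‖ₑ ≤ ENNReal.ofReal (Real.pi * ‖u‖ ^ 2) := by
  obtain ⟨x, hx, hxu⟩ := mem_closure_iff_seq_limit.1 (dense_span_expVec u)
  have hspan : ∀ n, ∫⁻ α, ‖‖⟪coherent α, x n⟫_ℂ‖ ^ 2‖ₑ =
      ENNReal.ofReal (Real.pi * ‖x n‖ ^ 2) := by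
    intro n
    obtain ⟨h1, h2⟩ := resolution_span (hx n) (hx n)
    simp only [inner_mul_inner_self] at h1 h2
    rw [integral_complex_ofReal, inner_self_eq_norm_sq_to_K] at h2
    have h3 : Integrable fun α => ‖⟪coherent α, x n⟫_ℂ‖ ^ 2 := by
      have := h1.re
      simpa only [RCLike.re_to_complex, Complex.ofReal_re] using this
    rw [← ofReal_integral_norm_eq_lintegral_enorm h3]
    congr 1
    simp only [norm_pow, norm_norm]
    refine Complex.ofReal_injective (h2.trans ?_)
    rw [Complex.ofReal_mul]
    congr 1
    exact (Complex.ofReal_pow _ _).symm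
  have hcont : ∀ v : Fock, Continuous fun α => ‖⟪coherent α, v⟫_ℂ‖ ^ 2 := fun v =>
    ((continuous_coherent.inner continuous_const).norm).pow 2
  have hlim : ∀ α, Tendsto (fun n => ‖‖⟪coherent α, x n⟫_ℂ‖ ^ 2‖ₑ) atTop
      (𝓝 ‖‖⟪coherent α, u⟫_ℂ‖ ^ 2‖ₑ) := fun α =>
    (((tendsto_const_nhds.inner hxu).norm).pow 2).enorm
  calc ∫⁻ α, ‖‖⟪coherent α, u⟫_ℂ‖ ^ 2‖ₑ
      = ∫⁻ α, liminf (fun n => ‖‖⟪coherent α, x n⟫_ℂ‖ ^ 2‖ₑ) atTop :=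
        lintegral_congr fun α => (hlim α).liminf_eq.symm
    _ ≤ liminf (fun n => ∫⁻ α, ‖‖⟪coherent α, x n⟫_ℂ‖ ^ 2‖ₑ) atTop :=
        lintegral_liminf_le fun n => (hcont (x n)).measurable.enorm
    _ = ENNReal.ofReal (Real.pi * ‖u‖ ^ 2) := by
        simp only [hspan]
        exact (ENNReal.tendsto_ofReal ((hxu.norm.pow 2).const_mul _)).liminf_eq

theorem integrable_norm_inner_coherent_sq (u : Fock) :
    Integrable fun α => ‖⟪coherent α, u⟫_ℂ‖ ^ 2 :=
  ⟨((continuous_coherent.inner continuous_const).norm.pow 2).aestronglyMeasurable,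
    (lintegral_norm_inner_coherent_sq_le u).trans_lt ENNReal.ofReal_lt_top⟩

theorem integral_norm_inner_coherent_sq_le (u : Fock) :
    ∫ α, ‖⟪coherent α, u⟫_ℂ‖ ^ 2 ≤ Real.pi * ‖u‖ ^ 2 := by
  have h := lintegral_norm_inner_coherent_sq_le u
  rw [← ofReal_integral_norm_eq_lintegral_enorm (integrable_norm_inner_coherent_sq u),
    ENNReal.ofReal_le_ofReal_iff (by positivity)] at h
  simpa only [norm_pow, norm_norm] using h

theorem integral_norm_inner_coherent_mul_le (u v : Fock) :
    Integrable (fun α => ‖⟪coherent α, u⟫_ℂ‖ * ‖⟪coherent α, v⟫_ℂ‖) ∧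
      ∫ α, ‖⟪coherent α, u⟫_ℂ‖ * ‖⟪coherent α, v⟫_ℂ‖ ≤ Real.pi * (‖u‖ * ‖v‖) := by
  have hc : ∀ v : Fock, Continuous fun α => ‖⟪coherent α, v⟫_ℂ‖ := fun v =>
    (continuous_coherent.inner continuous_const).norm
  have hm : ∀ v : Fock, MemLp (fun α => ‖⟪coherent α, v⟫_ℂ‖) 2 := fun v =>
    (memLp_two_iff_integrable_sq_norm (hc v).aestronglyMeasurable).2
      (by simpa only [norm_norm] using integrable_norm_inner_coherent_sq v)
  refine ⟨(hm u).integrable_mul (hm v), ?_⟩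
  have h := integral_mul_le_Lp_mul_Lq_of_nonneg (μ := volume) Real.HolderConjugate.two_two
    (f := fun α => ‖⟪coherent α, u⟫_ℂ‖) (g := fun α => ‖⟪coherent α, v⟫_ℂ‖)
    (Eventually.of_forall fun _ => norm_nonneg _) (Eventually.of_forall fun _ => norm_nonneg _)
    (by simpa using hm u) (by simpa using hm v)
  refine h.trans ?_
  simp only [Real.rpow_ofNat]
  rw [← Real.sqrt_eq_rpow, ← Real.sqrt_eq_rpow]
  have h2 : ∀ v : Fock, √(∫ α, ‖⟪coherent α, v⟫_ℂ‖ ^ 2) ≤ √Real.pi * ‖v‖ := fun v => by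
    refine (Real.sqrt_le_sqrt (integral_norm_inner_coherent_sq_le v)).trans (le_of_eq ?_)
    rw [Real.sqrt_mul Real.pi_pos.le, Real.sqrt_sq (norm_nonneg _)]
  refine (mul_le_mul (h2 u) (h2 v) (Real.sqrt_nonneg _) (by positivity)).trans (le_of_eq ?_)
  rw [mul_mul_mul_comm, Real.mul_self_sqrt Real.pi_pos.le]

/-! ### Phase space integrals -/

/-- The Husimi function `⟨α|X|α⟩` (without the factor `1/π`). -/
def husimi (X : Fock →L[ℂ] Fock) (α : ℂ) : ℂ := ⟪coherent α, X (coherent α)⟫_ℂ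

theorem continuous_husimi (X : Fock →L[ℂ] Fock) : Continuous (husimi X) :=
  continuous_coherent.inner (X.continuous.comp continuous_coherent)

theorem norm_husimi_le (X : Fock →L[ℂ] Fock) (α : ℂ) : ‖husimi X α‖ ≤ ‖X‖ := by
  refine (norm_inner_le_norm _ _).trans ?_
  have h := X.le_opNorm (coherent α)
  rw [norm_coherent, mul_one] at h
  rwa [norm_coherent, one_mul]

theorem inner_coherentProj (X : Fock →L[ℂ] Fock) (u v : Fock) (α : ℂ) :
    ⟪u, (coherentProj α ∘L X ∘L coherentProj α) v⟫_ℂ =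
      husimi X α * (⟪u, coherent α⟫_ℂ * ⟪coherent α, v⟫_ℂ) := by
  simp only [coherentProj, husimi, ContinuousLinearMap.comp_apply,
    InnerProductSpace.rankOne_apply, map_smul, inner_smul_right]
  ring

theorem integrable_husimi_mul (X : Fock →L[ℂ] Fock) (u v : Fock) :
    Integrable fun α => husimi X α * (⟪u, coherent α⟫_ℂ * ⟪coherent α, v⟫_ℂ) := by
  refine ((integral_norm_inner_coherent_mul_le u v).1.const_mul ‖X‖).mono'
    ((continuous_husimi X).mul (continuous_inner_coherent_mul u v)).aestronglyMeasurable
    (Eventually.of_forall fun α => ?_)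
  rw [norm_mul, norm_mul, ← inner_conj_symm u, RCLike.norm_conj]
  exact mul_le_mul_of_nonneg_right (norm_husimi_le X α) (by positivity)

/-- The phase space integral is a bounded sesquilinear form in `u`, `v`, hence given by an operator
`Z`; equal kernels on exponential vectors force `Y = Z`. -/
theorem isPhaseSpaceIntegral_of_kernel {X Y : Fock →L[ℂ] Fock}
    (h : ∀ β γ, ⟪expVec β, Y (expVec γ)⟫_ℂ =
      (Real.pi : ℂ)⁻¹ * ∫ α, husimi X α * gauss 1 (conj β) γ α) :
    IsPhaseSpaceIntegral (fun α => coherentProj α ∘L X ∘L coherentProj α) Y := by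
  have hi := integrable_husimi_mul X
  obtain ⟨Z, hZ⟩ := exists_clm_of_sesquilinear
    (fun u v => (Real.pi : ℂ)⁻¹ *
      ∫ α, husimi X α * (⟪u, coherent α⟫_ℂ * ⟪coherent α, v⟫_ℂ)) ‖X‖
    (fun u u' v => by
      rw [← mul_add, ← integral_add (hi u v) (hi u' v)]
      simp only [inner_add_left, add_mul, mul_add])
    (fun c u v => by
      rw [mul_left_comm, ← integral_const_mul (conj c)]
      simp only [inner_smul_left, mul_assoc, mul_left_comm (conj c)])
    (fun u v v' => by
      rw [← mul_add, ← integral_add (hi u v) (hi u v')]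
      simp only [inner_add_right, mul_add])
    (fun c u v => by
      rw [mul_left_comm, ← integral_const_mul c]
      simp only [inner_smul_right, mul_left_comm c])
    (fun u v => by
      have h1 : ‖∫ α, husimi X α * (⟪u, coherent α⟫_ℂ * ⟪coherent α, v⟫_ℂ)‖ ≤
          ‖X‖ * (Real.pi * (‖u‖ * ‖v‖)) := by
        obtain ⟨h1, h2⟩ := integral_norm_inner_coherent_mul_le u v
        refine (norm_integral_le_of_norm_le (h1.const_mul ‖X‖)
          (Eventually.of_forall fun α => ?_)).trans ?_
        · rw [norm_mul, norm_mul, ← inner_conj_symm u, RCLike.norm_conj]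
          exact mul_le_mul_of_nonneg_right (norm_husimi_le X α) (by positivity)
        · rw [integral_const_mul]
          exact mul_le_mul_of_nonneg_left h2 (norm_nonneg _)
      rw [norm_mul, norm_inv, Complex.norm_real, Real.norm_of_nonneg Real.pi_pos.le]
      refine (mul_le_mul_of_nonneg_left h1 (by positivity)).trans (le_of_eq ?_)
      field_simp)
  have hYZ : Y = Z := clm_ext_expVec fun β γ => by
    rw [h, hZ, ← resolution_expVec]
  intro u v
  simp only [inner_coherentProj]
  exact ⟨hi u v, by rw [hYZ, hZ]⟩

/-! ### Normal functionals -/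

section normal
variable {T : Type*} [MeasurableSpace T] {μ : Measure T}

theorem integrable_inner_clm {f g : T → Fock} (hf : AEStronglyMeasurable f μ)
    (hg : AEStronglyMeasurable g μ) (h : Integrable (fun t => ‖f t‖ * ‖g t‖) μ)
    (X : Fock →L[ℂ] Fock) : Integrable (fun t => ⟪f t, X (g t)⟫_ℂ) μ := by
  refine (h.const_mul ‖X‖).mono' (hf.inner (X.continuous.comp_aestronglyMeasurable hg))
    (Eventually.of_forall fun t => ?_)
  refine (norm_inner_le_norm _ _).trans ?_
  rw [mul_left_comm]
  exact mul_le_mul_of_nonneg_left (X.le_opNorm _) (norm_nonneg _)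

/-- The functional `X ↦ ∫ ⟪f t, X (g t)⟫`. -/
def normalFunctional {f g : T → Fock} (hf : AEStronglyMeasurable f μ)
    (hg : AEStronglyMeasurable g μ) (h : Integrable (fun t => ‖f t‖ * ‖g t‖) μ) :
    (Fock →L[ℂ] Fock) →L[ℂ] ℂ :=
  LinearMap.mkContinuous
    { toFun := fun X => ∫ t, ⟪f t, X (g t)⟫_ℂ ∂μ
      map_add' := fun X Y => by
        rw [← integral_add (integrable_inner_clm hf hg h X) (integrable_inner_clm hf hg h Y)]
        simp only [add_apply, inner_add_right]
      map_smul' := fun c X => by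
        rw [RingHom.id_apply, smul_eq_mul, ← integral_const_mul]
        simp only [smul_apply, inner_smul_right] }
    (∫ t, ‖f t‖ * ‖g t‖ ∂μ) fun X => by
      rw [mul_comm, ← integral_const_mul]
      refine norm_integral_le_of_norm_le (h.const_mul ‖X‖) (Eventually.of_forall fun t => ?_)
      refine (norm_inner_le_norm _ _).trans ?_
      rw [mul_left_comm]
      exact mul_le_mul_of_nonneg_left (X.le_opNorm _) (norm_nonneg _)

theorem normalFunctional_apply {f g : T → Fock} (hf : AEStronglyMeasurable f μ)
    (hg : AEStronglyMeasurable g μ) (h : Integrable (fun t => ‖f t‖ * ‖g t‖) μ)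
    (X : Fock →L[ℂ] Fock) : normalFunctional hf hg h X = ∫ t, ⟪f t, X (g t)⟫_ℂ ∂μ := rfl

theorem tendsto_normalFunctional {f g : T → Fock} (hf : AEStronglyMeasurable f μ)
    (hg : AEStronglyMeasurable g μ) (h : Integrable (fun t => ‖f t‖ * ‖g t‖) μ)
    {A : ℕ → Fock →L[ℂ] Fock} {X : Fock →L[ℂ] Fock}
    (hA : ∀ v, Tendsto (fun n => A n v) atTop (𝓝 (X v))) :
    Tendsto (fun n => normalFunctional hf hg h (A n)) atTop (𝓝 (normalFunctional hf hg h X)) := by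
  -- A strongly convergent sequence is norm bounded, which supplies the dominating function.
  obtain ⟨C, hC⟩ := banach_steinhaus fun v => by
    obtain ⟨C, hC⟩ := (hA v).norm.bddAbove_range
    exact ⟨C, fun n => hC ⟨n, rfl⟩⟩
  refine tendsto_integral_of_dominated_convergence (fun t => C * (‖f t‖ * ‖g t‖))
    (fun n => (integrable_inner_clm hf hg h (A n)).1) (h.const_mul C)
    (fun n => Eventually.of_forall fun t => ?_)
    (Eventually.of_forall fun t => tendsto_const_nhds.inner (hA (g t)))
  refine (norm_inner_le_norm _ _).trans ?_
  rw [mul_left_comm]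
  exact mul_le_mul_of_nonneg_left ((A n).le_of_opNorm_le (hC n) _) (norm_nonneg _)

end normal

/-- Functionals continuous for bounded strong convergence of sequences are determined by their
values on the operators `|e(γ)⟩⟨e(δ)|`. -/
theorem functional_ext {φ₁ φ₂ : (Fock →L[ℂ] Fock) →L[ℂ] ℂ}
    (h₁ : ∀ (A : ℕ → Fock →L[ℂ] Fock) (X : Fock →L[ℂ] Fock),
      (∀ v, Tendsto (fun n => A n v) atTop (𝓝 (X v))) →
        Tendsto (fun n => φ₁ (A n)) atTop (𝓝 (φ₁ X)))
    (h₂ : ∀ (A : ℕ → Fock →L[ℂ] Fock) (X : Fock →L[ℂ] Fock),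
      (∀ v, Tendsto (fun n => A n v) atTop (𝓝 (X v))) →
        Tendsto (fun n => φ₂ (A n)) atTop (𝓝 (φ₂ X)))
    (h : ∀ γ δ, φ₁ (InnerProductSpace.rankOne ℂ (expVec γ) (expVec δ)) =
      φ₂ (InnerProductSpace.rankOne ℂ (expVec γ) (expVec δ))) : φ₁ = φ₂ := by
  have hc₁ : ∀ y : Fock, Continuous fun x : Fock => InnerProductSpace.rankOne ℂ x y := fun y =>
    (continuous_eval_const y).comp (InnerProductSpace.rankOne ℂ).continuous
  have hc₂ : ∀ x : Fock, Continuous fun y : Fock => InnerProductSpace.rankOne ℂ x y := fun x =>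
    (InnerProductSpace.rankOne ℂ x).continuous
  have hr : ∀ x y : Fock, φ₁ (InnerProductSpace.rankOne ℂ x y) =
      φ₂ (InnerProductSpace.rankOne ℂ x y) := by
    intro x
    refine expVec_induction (fun δ => ?_) (by simp) (fun y y' hy hy' => ?_) (fun c y hy => ?_)
      (isClosed_eq (φ₁.continuous.comp (hc₂ x)) (φ₂.continuous.comp (hc₂ x)))
    · refine expVec_induction (P := fun x => φ₁ (InnerProductSpace.rankOne ℂ x (expVec δ)) =
        φ₂ (InnerProductSpace.rankOne ℂ x (expVec δ))) (fun γ => h γ δ) (by simp)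
        (fun x x' hx hx' => ?_) (fun c x hx => ?_)
        (isClosed_eq (φ₁.continuous.comp (hc₁ _)) (φ₂.continuous.comp (hc₁ _))) x
      · rw [map_add, add_apply, map_add, map_add, hx, hx']
      · rw [map_smul, smul_apply, map_smul, map_smul, hx]
    · rw [map_add, map_add, map_add, hy, hy']
    · rw [map_smulₛₗ, map_smul, map_smul, hy]
  ext X
  -- `X` composed with the projection on the first `n` number states: finite rank, and strongly
  -- convergent to `X`.
  let A : ℕ → Fock →L[ℂ] Fock := fun n =>
    ∑ k ∈ Finset.range n, InnerProductSpace.rankOne ℂ (X (ket k)) (ket k)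
  have hA : ∀ v, Tendsto (fun n => A n v) atTop (𝓝 (X v)) := by
    intro v
    have h1 := X.hasSum ((ketBasis ℕ).hasSum_repr v)
    refine h1.tendsto_sum_nat.congr fun n => ?_
    simp only [A, sum_apply, InnerProductSpace.rankOne_apply, inner_ket_left, map_smul,
      ketBasis_apply]
    rfl
  refine tendsto_nhds_unique (h₁ A X hA) ((h₂ A X hA).congr fun n => ?_)
  simp only [A, map_sum, hr]

/-! ### The channels on exponential vectors -/

theorem sqrt_two_mul_self : (√2 : ℂ) * (√2 : ℂ) = 2 := by
  rw [ofReal_sqrt_mul_self zero_le_two]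
  norm_num

theorem sqrt_two_ne_zero : (√2 : ℂ) ≠ 0 := by
  exact_mod_cast (Real.sqrt_pos.2 two_pos).ne'

theorem sqrt_factorial_ne_zero (n : ℕ) : (√(n.factorial : ℝ) : ℂ) ≠ 0 := by
  exact_mod_cast (Real.sqrt_pos.2 (by positivity)).ne'

theorem sqrt_factorial_add (k n : ℕ) : (√((k + n).factorial : ℝ) : ℂ) =
    √((k + n).choose n : ℝ) * √(k.factorial : ℝ) * √(n.factorial : ℝ) := by
  rw [← Complex.ofReal_mul, ← Complex.ofReal_mul, ← Real.sqrt_mul (by positivity),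
    ← Real.sqrt_mul (by positivity)]
  congr 2
  have h := Nat.add_choose_mul_factorial_mul_factorial k n
  exact_mod_cast h.symm

theorem sqrt_choose_ne_zero (k n : ℕ) : (√((k + n).choose n : ℝ) : ℂ) ≠ 0 := by
  have h : 0 < (k + n).choose n := Nat.choose_pos (Nat.le_add_left n k)
  exact_mod_cast (Real.sqrt_pos.2 (Nat.cast_pos.2 h)).ne'

/-- The binomial coefficient cancels against `√((k + n)!)`, so the adjoint Kraus operators send
exponential vectors to multiples of exponential vectors. -/
theorem amplifier_adjoint_expVec (β : ℂ) (n : ℕ) :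
    (vacuumIsometry (squeezing 2)).adjoint (tensor (expVec β) (ket n)) =
      ((β / √2) ^ n / (√2 * √(n.factorial : ℝ))) • expVec (β / √2) := by
  ext k
  rw [amplifier_adjoint_apply, expVec_apply, lp.coeFn_smul, Pi.smul_apply, expVec_apply,
    smul_eq_mul, sqrt_factorial_add]
  have h1 := sqrt_choose_ne_zero k n
  have h2 := sqrt_factorial_ne_zero k
  have h3 := sqrt_factorial_ne_zero n
  have h4 := sqrt_two_ne_zero
  push_cast
  simp only [div_pow, pow_add, pow_one]
  field_simp

theorem amplifier_kernel (X : Fock →L[ℂ] Fock) (β γ : ℂ) :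
    ⟪expVec β, amplifier 2 X (expVec γ)⟫_ℂ =
      1 / 2 * Complex.exp (conj β * γ / 2) * ⟪expVec (β / √2), X (expVec (γ / √2))⟫_ℂ := by
  refine (hasSum_of_isPartialTrace (isPartialTrace_amplifier X) _ _).unique ?_
  refine (((hasSum_pow_div_factorial (conj β * γ / 2)).mul_left (1 / 2)).mul_right
    ⟪expVec (β / √2), X (expVec (γ / √2))⟫_ℂ).congr_fun fun n => ?_
  rw [amplifier_adjoint_expVec, amplifier_adjoint_expVec, map_smul, inner_smul_left,
    inner_smul_right, ← mul_assoc]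
  congr 1
  simp only [map_div₀, map_pow, map_mul, Complex.conj_ofReal]
  rw [div_mul_div_comm, mul_mul_mul_comm, sqrt_two_mul_self, ofReal_sqrt_mul_self (by positivity),
    ← mul_pow, div_mul_div_comm, sqrt_two_mul_self, Complex.ofReal_natCast]
  field_simp

theorem husimi_eq (X : Fock →L[ℂ] Fock) (α : ℂ) :
    husimi X α = Complex.exp (-(‖α‖ ^ 2 : ℂ)) * ⟪expVec α, X (expVec α)⟫_ℂ := by
  rw [husimi, coherent_eq_smul_expVec, map_smul, inner_smul_left, inner_smul_right, ← mul_assoc,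
    Complex.conj_ofReal, ← Complex.ofReal_mul, ← Real.exp_add, Complex.ofReal_exp]
  congr 2
  push_cast
  ring

theorem norm_sq_eq_mul_conj (α : ℂ) : (‖α‖ ^ 2 : ℂ) = conj α * α := by
  rw [mul_comm, Complex.mul_conj, Complex.normSq_eq_norm_sq]
  push_cast
  ring

/-- On the diagonal of the kernel, `exp (-|α|²) exp (|α|²/2) = exp (-|α/√2|²)` is exactly the
normalization at `α/√2`. -/
theorem husimi_amplifier (X : Fock →L[ℂ] Fock) (α : ℂ) :
    husimi (amplifier 2 X) α = 1 / 2 * husimi X (α / √2) := by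
  rw [husimi_eq, husimi_eq, amplifier_kernel, norm_sq_eq_mul_conj, norm_sq_eq_mul_conj, map_div₀,
    Complex.conj_ofReal, div_mul_div_comm, sqrt_two_mul_self]
  have h : Complex.exp (-(conj α * α)) * Complex.exp (conj α * α / 2) =
      Complex.exp (-(conj α * α / 2)) := by
    rw [← Complex.exp_add]
    congr 1
    ring
  rw [← h]
  ring

/-- Here it is the Kraus operators, not their adjoints, that preserve exponential vectors up to a
factor: `e(δ)` goes to `(-δ/√2)ⁿ/√(n!) e(δ/√2)`. Hence the pairing with `e(δ)`. -/
theorem inner_attenuator_adjoint_expVec (β δ : ℂ) (n : ℕ) :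
    ⟪(vacuumIsometry (beamsplitter (1 / 2))).adjoint (tensor (expVec β) (ket n)), expVec δ⟫_ℂ =
      (-δ / √2) ^ n / √(n.factorial : ℝ) * Complex.exp (conj β * δ / √2) := by
  set x := (vacuumIsometry (beamsplitter (1 / 2))).adjoint (tensor (expVec β) (ket n)) with hx
  have h : HasSum (fun k => ⟪x k, expVec δ k⟫_ℂ) ⟪x, expVec δ⟫_ℂ := lp.hasSum_inner _ _
  have hi : Function.Injective fun j => n + j := fun a b h => Nat.add_left_cancel h
  have h0 : ∀ k ∉ Set.range fun j => n + j, ⟪x k, expVec δ k⟫_ℂ = 0 := by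
    intro k hk
    have hlt : k < n := by
      by_contra h
      exact hk ⟨k - n, by simp only; omega⟩
    rw [hx, attenuator_adjoint_apply_of_lt _ hlt, inner_zero_left]
  refine ((hi.hasSum_iff h0).2 h).unique ?_
  refine ((hasSum_pow_div_factorial (conj β * δ / √2)).mul_left _).congr_fun fun j => ?_
  rw [Function.comp_apply, hx, attenuator_adjoint_apply_of_le, expVec_apply, expVec_apply,
    RCLike.inner_apply, map_mul, Complex.conj_ofReal, map_div₀, map_pow, Complex.conj_ofReal,
    add_comm n j, sqrt_factorial_add]
  have h1 := sqrt_choose_ne_zero j n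
  have h2 := sqrt_factorial_ne_zero j
  have h3 := sqrt_factorial_ne_zero n
  have h4 := sqrt_two_ne_zero
  have h5 : (√(j.factorial : ℝ) : ℂ) * √(j.factorial : ℝ) = j.factorial := by
    rw [ofReal_sqrt_mul_self (by positivity), Complex.ofReal_natCast]
  rw [← h5]
  push_cast
  simp only [div_pow, pow_add, mul_pow, neg_pow δ]
  field_simp

theorem hasSum_attenuator_rankOne (β γ δ ε : ℂ) :
    HasSum (fun n =>
      ⟪(vacuumIsometry (beamsplitter (1 / 2))).adjoint (tensor (expVec β) (ket n)),
        InnerProductSpace.rankOne ℂ (expVec ε) (expVec δ)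
          ((vacuumIsometry (beamsplitter (1 / 2))).adjoint (tensor (expVec γ) (ket n)))⟫_ℂ)
      (Complex.exp (conj δ * ε / 2 + conj β * ε / √2 + conj δ * γ / √2)) := by
  rw [add_assoc, Complex.exp_add]
  refine ((hasSum_pow_div_factorial (conj δ * ε / 2)).mul_right _).congr_fun fun n => ?_
  rw [InnerProductSpace.rankOne_apply, inner_smul_right, inner_attenuator_adjoint_expVec,
    ← inner_conj_symm, inner_attenuator_adjoint_expVec, Complex.exp_add]
  simp only [map_mul, map_div₀, map_pow, map_neg, Complex.conj_ofReal, ← Complex.exp_conj,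
    Complex.conj_conj]
  have h : (-conj δ / √2) ^ n / √(n.factorial : ℝ) * ((-ε / √2) ^ n / √(n.factorial : ℝ)) =
      (conj δ * ε / 2) ^ n / n.factorial := by
    rw [div_mul_div_comm, ← mul_pow, div_mul_div_comm, sqrt_two_mul_self, neg_mul_neg,
      ofReal_sqrt_mul_self (by positivity), Complex.ofReal_natCast]
  rw [← h, mul_comm γ (conj δ)]
  ring

/-- The density in the integral representation of the attenuator. -/
def attenuatorDensity (β γ α : ℂ) : ℂ :=
  2 / Real.pi * Complex.exp (-(conj β * γ)) * gauss 1 (√2 * conj β) (√2 * γ) α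

theorem integrable_attenuatorDensity (β γ : ℂ) : Integrable (attenuatorDensity β γ) :=
  (integrable_gauss one_pos _ _).const_mul _

theorem husimi_rankOne (δ ε α : ℂ) :
    husimi (InnerProductSpace.rankOne ℂ (expVec ε) (expVec δ)) α = gauss 1 (conj δ) ε α := by
  rw [husimi, InnerProductSpace.rankOne_apply, inner_smul_right, ← resolution_expVec]

theorem gauss_mul_gauss (c d : ℝ) (a b a' b' α : ℂ) :
    gauss c a b α * gauss d a' b' α = gauss (c + d) (a + a') (b + b') α := by
  rw [gauss, gauss, gauss, ← Complex.exp_add]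
  congr 1
  push_cast
  ring

theorem integral_attenuatorDensity_rankOne (β γ δ ε : ℂ) :
    ∫ α, attenuatorDensity β γ α *
      husimi (InnerProductSpace.rankOne ℂ (expVec ε) (expVec δ)) α =
      Complex.exp (conj δ * ε / 2 + conj β * ε / √2 + conj δ * γ / √2) := by
  simp only [attenuatorDensity, husimi_rankOne, mul_assoc, gauss_mul_gauss]
  rw [integral_const_mul, integral_const_mul, integral_gauss (by norm_num)]
  have hpi : (Real.pi : ℂ) ≠ 0 := by exact_mod_cast Real.pi_pos.ne'
  have h : Complex.exp (-(conj β * γ)) *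
      Complex.exp ((√2 * conj β + conj δ) * (√2 * γ + ε) / (1 + 1 : ℝ)) =
      Complex.exp (conj δ * ε / 2 + conj β * ε / √2 + conj δ * γ / √2) := by
    rw [← Complex.exp_add]
    congr 1
    have h4 := sqrt_two_ne_zero
    have h5 := sqrt_two_mul_self
    push_cast
    field_simp
    linear_combination (2 * (√2 * conj β * γ + ε * conj β + γ * conj δ)) * h5
  rw [← h]
  push_cast
  field_simp
  norm_num

/-- The density is `2/π` times the kernel of the parity operator displaced by `α/√2`, so the
attenuator is the Weyl quantization of a rescaled Husimi function. Both sides are normal functionals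
of `X`, one over counting measure and one over the plane, and they agree on the operators
`|e(ε)⟩⟨e(δ)|`. -/
theorem attenuator_kernel (X : Fock →L[ℂ] Fock) (β γ : ℂ) :
    ⟪expVec β, attenuator (1 / 2) X (expVec γ)⟫_ℂ =
      ∫ α, attenuatorDensity β γ α * husimi X α := by
  let f : ℂ → ℕ → Fock := fun β n =>
    (vacuumIsometry (beamsplitter (1 / 2))).adjoint (tensor (expVec β) (ket n))
  have hf : ∀ β, AEStronglyMeasurable (f β) Measure.count := fun β =>
    continuous_of_discreteTopology.aestronglyMeasurable
  have hfg : Integrable (fun n => ‖f β n‖ * ‖f γ n‖) Measure.count := by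
    rw [integrable_count_iff]
    have h := (norm_tsum_inner_le (by positivity) (by positivity)
      (hasSum_attenuator (expVec β)) (hasSum_attenuator (expVec γ))).1
    simpa only [norm_mul, norm_norm] using h
  -- The inner product is conjugate linear on the left, which undoes this conjugation.
  let g : ℂ → Fock := fun α => conj (attenuatorDensity β γ α) • coherent α
  have hg : AEStronglyMeasurable g volume :=
    (RCLike.continuous_conj.comp_aestronglyMeasurable
      (integrable_attenuatorDensity β γ).1).smul continuous_coherent.aestronglyMeasurable
  have hgc : Integrable (fun α => ‖g α‖ * ‖coherent α‖) := by
    refine (integrable_attenuatorDensity β γ).norm.congr (Eventually.of_forall fun α => ?_)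
    simp only [g, norm_smul, norm_coherent, mul_one, RCLike.norm_conj]
  have h₁ : ∀ X, normalFunctional (hf β) (hf γ) hfg X = ∑' n, ⟪f β n, X (f γ n)⟫_ℂ := by
    intro X
    rw [normalFunctional_apply,
      integral_countable (integrable_inner_clm (hf β) (hf γ) hfg X)]
    simp
  have h₂ : ∀ X, normalFunctional hg continuous_coherent.aestronglyMeasurable hgc X =
      ∫ α, attenuatorDensity β γ α * husimi X α := by
    intro X
    rw [normalFunctional_apply]
    simp only [g, inner_smul_left, Complex.conj_conj]
    rfl
  have h := functional_ext (φ₁ := normalFunctional (hf β) (hf γ) hfg)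
    (φ₂ := normalFunctional hg continuous_coherent.aestronglyMeasurable hgc)
    (fun A X => tendsto_normalFunctional (hf β) (hf γ) hfg)
    (fun A X => tendsto_normalFunctional hg continuous_coherent.aestronglyMeasurable hgc)
    (fun ε δ => by
      rw [h₁, h₂, integral_attenuatorDensity_rankOne]
      exact (hasSum_attenuator_rankOne β γ δ ε).tsum_eq)
  rw [← h₂, ← h, h₁]
  exact (hasSum_of_isPartialTrace (isPartialTrace_attenuator X) _ _).tsum_eq.symm

/-- The kernel of the channel "measure and prepare coherent states". -/
theorem amplifier_attenuator_kernel (X : Fock →L[ℂ] Fock) (β γ : ℂ) :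
    ⟪expVec β, amplifier 2 (attenuator (1 / 2) X) (expVec γ)⟫_ℂ =
      (Real.pi : ℂ)⁻¹ * ∫ α, husimi X α * gauss 1 (conj β) γ α := by
  rw [amplifier_kernel, attenuator_kernel]
  have h4 := sqrt_two_ne_zero
  have h1 : ∀ α, attenuatorDensity (β / √2) (γ / √2) α * husimi X α =
      2 / Real.pi * Complex.exp (-(conj β * γ / 2)) * (husimi X α * gauss 1 (conj β) γ α) := by
    intro α
    rw [attenuatorDensity, map_div₀, Complex.conj_ofReal, mul_div_cancel₀ _ h4,
      mul_div_cancel₀ _ h4, div_mul_div_comm, sqrt_two_mul_self]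
    ring
  simp only [h1]
  rw [integral_const_mul, Complex.exp_neg]
  have h2 := Complex.exp_ne_zero (conj β * γ / 2)
  field_simp

/-! ### The square of the channel -/

theorem norm_gauss (c : ℝ) (a b α : ℂ) :
    ‖gauss c a b α‖ = Real.exp (-c * ‖α‖ ^ 2 + (a * α + b * conj α).re) := by
  rw [gauss, Complex.norm_exp, add_assoc, Complex.add_re]
  congr 2
  rw [← Complex.ofReal_pow, ← Complex.ofReal_neg, ← Complex.ofReal_mul, Complex.ofReal_re]

/-- The joint integrand of the attenuator after a measurement of coherent states. -/
def doubleGauss (a b : ℂ) (p : ℂ × ℂ) : ℂ :=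
  gauss 1 a b p.1 * (Complex.exp (-(‖p.1‖ ^ 2 : ℂ)) * gauss 1 (conj p.1) p.1 p.2)

/-- The majorant for Fubini: the coupling `2 |p.1| |p.2|` is split so that a decaying Gaussian is
left in each variable. -/
theorem norm_doubleGauss_le (a b : ℂ) (p : ℂ × ℂ) :
    ‖doubleGauss a b p‖ ≤ ‖gauss (1 / 2) a b p.1‖ * ‖gauss (1 / 3) 0 0 p.2‖ := by
  have h1 : ‖Complex.exp (-(‖p.1‖ ^ 2 : ℂ))‖ = Real.exp (-‖p.1‖ ^ 2) := by
    rw [Complex.norm_exp, ← Complex.ofReal_pow, ← Complex.ofReal_neg, Complex.ofReal_re]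
  have h2 : (conj p.1 * p.2 + p.1 * conj p.2).re ≤ 2 * (‖p.1‖ * ‖p.2‖) := by
    refine (Complex.re_le_norm _).trans ((norm_add_le _ _).trans (le_of_eq ?_))
    rw [norm_mul, norm_mul, RCLike.norm_conj, RCLike.norm_conj]
    ring
  rw [doubleGauss, norm_mul, norm_mul, h1, norm_gauss, norm_gauss, norm_gauss, norm_gauss,
    ← Real.exp_add, ← Real.exp_add, ← Real.exp_add, Real.exp_le_exp]
  simp only [zero_mul, add_zero, Complex.zero_re]
  -- With `x = ‖p.1‖` and `y = ‖p.2‖`: `(3/2) x² + (2/3) y² - 2xy = (3x - 2y)² / 6`.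
  nlinarith [sq_nonneg (3 * ‖p.1‖ - 2 * ‖p.2‖)]

theorem continuous_doubleGauss (a b : ℂ) : Continuous (doubleGauss a b) := by
  unfold doubleGauss gauss
  fun_prop

theorem integrable_doubleGauss_mul_husimi (Y : Fock →L[ℂ] Fock) (a b : ℂ) :
    Integrable (fun p : ℂ × ℂ => doubleGauss a b p * husimi Y p.2) := by
  have h := ((integrable_gauss (c := 1 / 2) (by norm_num) a b).norm.mul_prod
    (integrable_gauss (c := 1 / 3) (by norm_num) 0 0).norm).const_mul ‖Y‖
  refine h.mono' ((continuous_doubleGauss a b).mul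
    ((continuous_husimi Y).comp continuous_snd)).aestronglyMeasurable
    (Eventually.of_forall fun p => ?_)
  rw [norm_mul, mul_comm]
  exact mul_le_mul (norm_husimi_le Y p.2) (norm_doubleGauss_le a b p) (norm_nonneg _)
    (norm_nonneg _)

theorem integral_doubleGauss (a b ζ : ℂ) : ∫ α, doubleGauss a b (α, ζ) =
    Real.pi / 2 * (Complex.exp (a * b / 2) * gauss (1 / 2) (a / 2) (b / 2) ζ) := by
  have h1 : ∀ α, doubleGauss a b (α, ζ) =
      Complex.exp (-(‖ζ‖ ^ 2 : ℂ)) * gauss 2 (a + conj ζ) (b + ζ) α := by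
    intro α
    simp only [doubleGauss, gauss]
    rw [← Complex.exp_add, ← Complex.exp_add, ← Complex.exp_add]
    congr 1
    push_cast
    ring
  simp only [h1]
  rw [integral_const_mul, integral_gauss two_pos, mul_left_comm, gauss, ← Complex.exp_add,
    ← Complex.exp_add, norm_sq_eq_mul_conj]
  push_cast
  congr 2
  ring

theorem husimi_amplifier_attenuator (Y : Fock →L[ℂ] Fock) (α : ℂ) :
    husimi (amplifier 2 (attenuator (1 / 2) Y)) α = (Real.pi : ℂ)⁻¹ *
      ∫ ζ, Complex.exp (-(‖α‖ ^ 2 : ℂ)) * gauss 1 (conj α) α ζ * husimi Y ζ := by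
  rw [husimi_eq, amplifier_attenuator_kernel, mul_left_comm, ← integral_const_mul]
  congr 2
  funext ζ
  ring

/-- The Gaussian on the right is `⟨e(β)|ζ/√2⟩⟨ζ/√2|e(γ)⟩`: attenuating after measure-and-prepare
replaces the prepared `|ζ⟩` by `|ζ/√2⟩`. Fubini makes the integral over the attenuator's variable an
explicit Gaussian one. -/
theorem attenuator_amplifier_attenuator_kernel (Y : Fock →L[ℂ] Fock) (β γ : ℂ) :
    ⟪expVec β, attenuator (1 / 2) (amplifier 2 (attenuator (1 / 2) Y)) (expVec γ)⟫_ℂ =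
      (Real.pi : ℂ)⁻¹ * ∫ ζ, husimi Y ζ * gauss (1 / 2) (conj β / √2) (γ / √2) ζ := by
  have hpi : (Real.pi : ℂ) ≠ 0 := by exact_mod_cast Real.pi_pos.ne'
  have h4 := sqrt_two_ne_zero
  have h5 := sqrt_two_mul_self
  set a : ℂ := √2 * conj β with ha
  set b : ℂ := √2 * γ with hb
  have ha2 : a / 2 = conj β / √2 := by
    rw [ha]
    field_simp
    linear_combination conj β * h5
  have hb2 : b / 2 = γ / √2 := by
    rw [hb]
    field_simp
    linear_combination γ * h5
  have hab : a * b / 2 = conj β * γ := by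
    rw [ha, hb]
    linear_combination (conj β * γ / 2) * h5
  have h1 : ∀ α, attenuatorDensity β γ α * husimi (amplifier 2 (attenuator (1 / 2) Y)) α =
      2 / Real.pi * Complex.exp (-(conj β * γ)) * (Real.pi : ℂ)⁻¹ *
        ∫ ζ, doubleGauss a b (α, ζ) * husimi Y ζ := by
    intro α
    rw [husimi_amplifier_attenuator, attenuatorDensity]
    have h2 : ∫ ζ, doubleGauss a b (α, ζ) * husimi Y ζ = gauss 1 a b α *
        ∫ ζ, Complex.exp (-(‖α‖ ^ 2 : ℂ)) * gauss 1 (conj α) α ζ * husimi Y ζ := by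
      rw [← integral_const_mul]
      congr 1
      funext ζ
      rw [doubleGauss]
      ring
    rw [h2]
    ring
  rw [attenuator_kernel]
  simp only [h1]
  rw [integral_const_mul, integral_integral_swap (integrable_doubleGauss_mul_husimi Y a b)]
  have h2 : ∀ ζ, ∫ α, doubleGauss a b (α, ζ) * husimi Y ζ =
      Real.pi / 2 * Complex.exp (conj β * γ) *
        (husimi Y ζ * gauss (1 / 2) (conj β / √2) (γ / √2) ζ) := by
    intro ζ
    rw [integral_mul_const, integral_doubleGauss, hab, ha2, hb2]
    ring
  simp only [h2]
  rw [integral_const_mul, Complex.exp_neg]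
  have h3 := Complex.exp_ne_zero (conj β * γ)
  field_simp

/-- The substitution `ζ = √2 α` undoes both scalings, and its Jacobian 2 cancels the factor `1/2` of
`husimi_amplifier`. -/
theorem channelC_channelC_kernel (X : Fock →L[ℂ] Fock) (β γ : ℂ) :
    ⟪expVec β, channelC (channelC X) (expVec γ)⟫_ℂ =
      (Real.pi : ℂ)⁻¹ * ∫ α, husimi X α * gauss 1 (conj β) γ α := by
  have h4 := sqrt_two_ne_zero
  have h5 := sqrt_two_mul_self
  change ⟪expVec β, attenuator (1 / 2) (amplifier 2 (attenuator (1 / 2) (amplifier 2 X)))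
    (expVec γ)⟫_ℂ = _
  rw [attenuator_amplifier_attenuator_kernel]
  congr 1
  have h := Measure.integral_comp_smul (volume : Measure ℂ)
    (fun ζ => husimi (amplifier 2 X) ζ * gauss (1 / 2) (conj β / √2) (γ / √2) ζ) (√2)
  rw [Complex.finrank_real_complex, Real.sq_sqrt zero_le_two] at h
  have h1 : ∀ α : ℂ, husimi (amplifier 2 X) (√2 • α) *
      gauss (1 / 2) (conj β / √2) (γ / √2) (√2 • α) =
      1 / 2 * (husimi X α * gauss 1 (conj β) γ α) := by
    intro α
    rw [husimi_amplifier, Complex.real_smul, mul_div_cancel_left₀ _ h4]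
    have h2 : gauss (1 / 2) (conj β / √2) (γ / √2) (√2 * α) = gauss 1 (conj β) γ α := by
      rw [gauss, gauss, norm_sq_eq_mul_conj, norm_sq_eq_mul_conj, map_mul, Complex.conj_ofReal]
      congr 1
      push_cast
      field_simp
      linear_combination (-(α * conj α)) * h5
    rw [h2]
    ring
  simp only [h1] at h
  rw [integral_const_mul, abs_of_pos (by norm_num), Complex.real_smul] at h
  push_cast at h
  linear_combination (-2 : ℂ) * h

theorem channelC_channelC (X : Fock →L[ℂ] Fock) :
    channelC (channelC X) = amplifier 2 (attenuator (1 / 2) X) :=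
  clm_ext_expVec fun β γ => by
    rw [channelC_channelC_kernel, amplifier_attenuator_kernel]

end

end BosonicChannels

theorem mainTheorem2 :
    -- the two unitary operators and all the partial traces involved are well defined
    (∃! U, BosonicChannels.IsUnitaryExp (BosonicChannels.squeezingGenerator 2) U) ∧
    (∃! U, BosonicChannels.IsUnitaryExp (BosonicChannels.beamsplitterGenerator (1 / 2)) U) ∧
    (∀ X : BosonicChannels.Fock →L[ℂ] BosonicChannels.Fock,
      BosonicChannels.IsPartialTrace
        (BosonicChannels.dilation (BosonicChannels.squeezing 2) X)
        (BosonicChannels.amplifier 2 X) ∧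
      BosonicChannels.IsPartialTrace
        (BosonicChannels.dilation (BosonicChannels.beamsplitter (1 / 2)) X)
        (BosonicChannels.attenuator (1 / 2) X)) ∧
    -- the two representations of the square of the channel
    BosonicChannels.channelC ∘ BosonicChannels.channelC =
      BosonicChannels.amplifier 2 ∘ BosonicChannels.attenuator (1 / 2) ∧
    (∀ X : BosonicChannels.Fock →L[ℂ] BosonicChannels.Fock,
      BosonicChannels.IsPhaseSpaceIntegral
        (fun α => BosonicChannels.coherentProj α ∘L X ∘L BosonicChannels.coherentProj α)
        ((BosonicChannels.channelC ∘ BosonicChannels.channelC) X)) := by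
  -- The two generators are by definition `squeezeGen` and `rotateGen` at the angles `arcosh √2` and
  -- `arccos √(1/2)`.
  refine ⟨BosonicChannels.existsUnique_isUnitaryExp (BosonicChannels.isSkewLadder_squeezeGen _),
    BosonicChannels.existsUnique_isUnitaryExp (BosonicChannels.isSkewLadder_rotateGen _),
    fun X => ⟨BosonicChannels.isPartialTrace_amplifier X,
      BosonicChannels.isPartialTrace_attenuator X⟩,
    funext BosonicChannels.channelC_channelC, fun X => ?_⟩
  exact BosonicChannels.isPhaseSpaceIntegral_of_kernel
    (BosonicChannels.channelC_channelC_kernel X)
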